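/- Let $n\ge 1$ and let $s=(s_\alpha)_{\alpha\in\mathbb N_0^n}$ be a real sequence. Let $L_s:\mathbb R[x_1,\dots,x_n]\to\mathbb R$ be the linear functional with $L_s(x^\alpha)=s_\alpha$, and let $\partial_1\cdots\partial_n s$ be the sequence with entries $(\partial_1\cdots\partial_n s)_\alpha=(-1)^n L_s(\partial_1\cdots\partial_n x^\alpha)$. Then the following are equivalent: (i) There exists an integrable, almost everywhere continuous function $f:[0,1]^n\to\mathbb R$ such that $s_\alpha=\int_{[0,1]^n}x^\alpha f(x)\,\mathrm dx$ for all $\alpha\in\mathbb N_0^n$ and such that $\partial_1\cdots\partial_n f$ is a regular (finite) signed Borel measure on $[0,1]^n$; here the derivative is the distributional derivative on $\mathbb R^n$ of $f$ extended by $0$ outside $[0,1]^n$, i.e. there are finite regular positive Borel measures $\mu_1,\mu_2$ on $[0,1]^n$ with $(-1)^n\int_{[0,1]^n} f\,\partial_1\cdots\partial_n\varphi\,\mathrm dx=\int\varphi\,\mathrm d\mu_1-\int\varphi\,\mathrm d\mu_2$ for all $\varphi\in C_c^\infty(\mathbb R^n)$. (ii) There exists a constant $C>0$ such that for all $d_1,\dots,d_n\in\mathbb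 N_0$ both \[\sum_{k_1=0}^{d_1}\cdots\sum_{k_n=0}^{d_n}\binom{d_1}{k_1}\cdots\binom{d_n}{k_n}\,\Big|L_{s}\Big(\prod_{i=1}^n x_i^{k_i}(1-x_i)^{d_i-k_i}\Big)\Big|<C\] and \[\sum_{k_1=0}^{d_1}\cdots\sum_{k_n=0}^{d_n}\binom{d_1}{k_1}\cdots\binom{d_n}{k_n}\,\Big|L_{\partial_1\cdots\partial_n s}\Big(\prod_{i=1}^n x_i^{k_i}(1-x_i)^{d_i-k_i}\Big)\Big|<C .\] Suppose additionally that $L_s\big(\prod_{i=1}^n x_i^{k_i}(1-x_i)^{l_i}\big)\ge 0$ for all $k_1,\dots,k_n,l_1,\dots,l_n\in\mathbb N_0$. Then every $f$ as in (i) satisfies $f\ge 0$ almost everywhere on $[0,1]^n$ and at every point of $[0,1]^n$ at which $f$ is continuous; and if (i) holds, then $f$ in (i) can be chosen such that $f\ge 0$ everywhere on $[0,1]^n$. -/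

import Mathlib

open MeasureTheory
open scoped Distributions LineDeriv

noncomputable section

namespace CubeMoment

/-- The unit cube `[0,1]^n` in `ℝ^n`. -/
def unitCube (n : ℕ) : Set (Fin n → ℝ) := Set.Icc 0 1

/-- The functional `L_s : ℝ[x_1,…,x_n] → ℝ` of a real multi-sequence `s`, i.e. the linear map
with `L_s(x^α) = s_α`. -/
def rieszFunctional {n : ℕ} (s : (Fin n →₀ ℕ) → ℝ) : MvPolynomial (Fin n) ℝ →ₗ[ℝ] ℝ :=
  (MvPolynomial.basisMonomials (Fin n) ℝ).constr ℝ s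

/-- The mixed partial derivative `∂_1 ⋯ ∂_n p` of a polynomial. -/
def mixedPartial {n : ℕ} (p : MvPolynomial (Fin n) ℝ) : MvPolynomial (Fin n) ℝ :=
  (List.finRange n).foldr (fun i q => MvPolynomial.pderiv i q) p

/-- The derivative `∂_1 ⋯ ∂_n s` of a multi-sequence, `(∂_1 ⋯ ∂_n s)_α = (-1)^n L_s(∂_1 ⋯ ∂_n x^α)`. -/
def mixedDerivSeq {n : ℕ} (s : (Fin n →₀ ℕ) → ℝ) : (Fin n →₀ ℕ) → ℝ :=
  fun α => (-1) ^ n * rieszFunctional s (mixedPartial (MvPolynomial.monomial α 1))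

/-- The polynomial `x_1^{k_1} ⋯ x_n^{k_n} (1 - x_1)^{l_1} ⋯ (1 - x_n)^{l_n}`. -/
def bernsteinProd {n : ℕ} (k l : Fin n → ℕ) : MvPolynomial (Fin n) ℝ :=
  (∏ i, MvPolynomial.X i ^ k i) * ∏ i, (1 - MvPolynomial.X i) ^ l i

/-- The multivariate Bernstein sum
`∑_{k_1 ≤ d_1} ⋯ ∑_{k_n ≤ d_n} ∏_i (d_i choose k_i) |L_s(∏_i x_i^{k_i} (1 - x_i)^{d_i - k_i})|`. -/
def bernsteinSum {n : ℕ} (s : (Fin n →₀ ℕ) → ℝ) (d : Fin n → ℕ) : ℝ :=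
  ∑ k ∈ Fintype.piFinset (fun i => Finset.range (d i + 1)),
    (∏ i, ((d i).choose (k i) : ℝ)) *
      |rieszFunctional s (bernsteinProd k (fun i => d i - k i))|

/-- The distribution `∂_1 ⋯ ∂_n f` on `ℝ^n`, where `f` is extended by zero outside `[0,1]^n`, is a
regular signed measure `μ₁ - μ₂` on `[0,1]^n`. Here `∂^{e} φ` is the mixed partial derivative
`∂_1 ⋯ ∂_n φ` of the test function `φ`. -/
def MixedDerivIsSignedMeasure {n : ℕ} (f : (Fin n → ℝ) → ℝ) : Prop :=
  ∃ μ₁ μ₂ : Measure (Fin n → ℝ),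
    IsFiniteMeasure μ₁ ∧ IsFiniteMeasure μ₂ ∧ μ₁.Regular ∧ μ₂.Regular ∧
    μ₁ (unitCube n)ᶜ = 0 ∧ μ₂ (unitCube n)ᶜ = 0 ∧
    ∀ φ : 𝓓((⊤ : TopologicalSpace.Opens (Fin n → ℝ)), ℝ),
      (-1) ^ n * ∫ x in unitCube n, f x * (∂^{fun i : Fin n => (Pi.single i 1 : Fin n → ℝ)} φ) x =
        (∫ x, φ x ∂μ₁) - ∫ x, φ x ∂μ₂

/-- `f : [0,1]^n → ℝ` is an integrable, almost everywhere continuous function with moments `s`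
whose distributional derivative `∂_1 ⋯ ∂_n f` is a regular signed measure. Only the values of `f`
on the cube matter. -/
structure IsRegularDensity {n : ℕ} (s : (Fin n →₀ ℕ) → ℝ) (f : (Fin n → ℝ) → ℝ) : Prop where
  ae_continuous : ∀ᵐ x ∂(volume.restrict (unitCube n)), ContinuousWithinAt f (unitCube n) x
  integrableOn : IntegrableOn f (unitCube n)
  moments : ∀ α : Fin n →₀ ℕ, s α = ∫ x in unitCube n, (∏ i, x i ^ α i) * f x
  mixedDeriv : MixedDerivIsSignedMeasure f

end CubeMoment

end

namespace CubeMoment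

open scoped ContDiff
open Filter

/-! (i) ⇒ (ii): the weighted Bernstein products are nonnegative on the cube and sum to 1, so the two
sums are at most `∫ |f|` and the total mass of `μ₁ + μ₂` (`bernsteinSum_le_integral`). The second
bound uses that a polynomial agrees near the cube with a test function, which turns `L_{∂s}(p)` into
`∫ p dμ₁ - ∫ p dμ₂`.

(ii) ⇒ (i): `L(p)` is the limit of the grid sums `∑ p(k/N) L(B_{N,k})`. For `L = L_{∂s}` the
positive and negative parts of these weights have bounded mass, and their weak limits are measures
`μ₁`, `μ₂` representing `L_{∂s}` (`exists_measures_of_sum_abs_bernsteinBasis_le`). The density is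
the distribution function `f(y) = μ₁(Iic y) - μ₂(Iic y)`. Fubini reduces its moments to integrals
over the boxes `[a, 1]`, and its mixed derivative is `μ₁ - μ₂` when tested on polynomials. A mixed
derivative integrates over a box to an alternating vertex sum, so both sides of the distributional
identity are controlled by the sup norm of the test function alone; uniform polynomial approximation
then suffices, with no control of derivatives.

Nonnegativity: the grid sums show `L_s(p) ≥ 0` whenever `p ≥ 0` on the cube. Weierstrass passes from
polynomials to continuous functions, `L¹(|f| dx)` approximation to indicators. Hence `f ≥ 0` almost
everywhere, and `max f 0` is again a valid density. -/

/-- The iterated directional derivative of `g` along the directions of a list. -/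
noncomputable def dirDeriv {E : Type*} [NormedAddCommGroup E] [NormedSpace ℝ E]
    (l : List E) (g : E → ℝ) : E → ℝ :=
  l.foldr (fun v h x => fderiv ℝ h x v) g

/-! ### Iterated directional derivatives of smooth functions. -/

section DirDeriv

variable {E F : Type*} [NormedAddCommGroup E] [NormedSpace ℝ E]
  [NormedAddCommGroup F] [NormedSpace ℝ F]

theorem dirDeriv_nil (g : E → ℝ) : dirDeriv [] g = g := rfl

theorem dirDeriv_cons (v : E) (l : List E) (g : E → ℝ) :
    dirDeriv (v :: l) g = fun x => fderiv ℝ (dirDeriv l g) x v := rfl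

theorem contDiff_dirDeriv {g : E → ℝ} (hg : ContDiff ℝ ∞ g) (l : List E) :
    ContDiff ℝ ∞ (dirDeriv l g) := by
  induction l with
  | nil => exact hg
  | cons v l ih =>
    rw [dirDeriv_cons]
    exact (ih.fderiv_right (m := ∞) (by norm_cast)).clm_apply contDiff_const

theorem dirDeriv_sub {f g : E → ℝ} (hf : ContDiff ℝ ∞ f) (hg : ContDiff ℝ ∞ g) (l : List E) :
    dirDeriv l (f - g) = dirDeriv l f - dirDeriv l g := by
  induction l with
  | nil => rfl
  | cons v l ih =>
    ext x
    have h1 := ((contDiff_dirDeriv hf l).differentiable (by simp)) x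
    have h2 := ((contDiff_dirDeriv hg l).differentiable (by simp)) x
    simp only [dirDeriv_cons, ih, Pi.sub_apply]
    rw [fderiv_sub h1 h2]
    rfl

theorem dirDeriv_congr {f g : E → ℝ} {x : E} (h : f =ᶠ[nhds x] g) (l : List E) :
    dirDeriv l f =ᶠ[nhds x] dirDeriv l g := by
  induction l with
  | nil => exact h
  | cons v l ih =>
    filter_upwards [ih.fderiv (𝕜 := ℝ)] with y hy
    simp only [dirDeriv_cons, hy]

theorem dirDeriv_comp_affine {g : E → ℝ} (hg : ContDiff ℝ ∞ g) (c : E) (L : F →L[ℝ] E)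
    (l : List F) :
    dirDeriv l (fun y => g (c + L y)) = fun y => dirDeriv (l.map L) g (c + L y) := by
  induction l with
  | nil => rfl
  | cons v l ih =>
    ext y
    rw [List.map_cons, dirDeriv_cons, dirDeriv_cons, ih]
    have h1 := (((contDiff_dirDeriv hg (l.map L)).differentiable (by simp)) (c + L y)).hasFDerivAt
    have h2 : HasFDerivAt (fun y => c + L y) L y := L.hasFDerivAt.const_add c
    have h3 := (h1.comp y h2).fderiv
    simp only [Function.comp_def] at h3
    beta_reduce
    rw [h3]
    rfl

end DirDeriv

/-! ### Mixed partial derivatives of test functions and polynomials. -/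

/-- The mixed partial derivative `∂_1 ⋯ ∂_n g` of a function. -/
noncomputable def mixedDeriv {n : ℕ} (g : (Fin n → ℝ) → ℝ) : (Fin n → ℝ) → ℝ :=
  dirDeriv (List.ofFn fun i : Fin n => (Pi.single i 1 : Fin n → ℝ)) g

theorem iteratedLineDerivOp_eq_dirDeriv {E : Type*} [NormedAddCommGroup E] [NormedSpace ℝ E]
    (φ : 𝓓((⊤ : TopologicalSpace.Opens E), ℝ)) {k : ℕ} (m : Fin k → E) :
    (⇑(∂^{m} φ) : E → ℝ) = dirDeriv (List.ofFn m) φ := by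
  induction k with
  | zero => rfl
  | succ k ih =>
    ext x
    rw [LineDeriv.iteratedLineDerivOp_succ_left, List.ofFn_succ, dirDeriv_cons,
      TestFunction.lineDerivOp_eq_lineDerivCLM (𝕜 := ℝ),
      TestFunction.lineDerivCLM_apply_of_le (by simp), DifferentiableAt.lineDeriv_eq_fderiv, ih]
    · rfl
    · exact ((∂^{Fin.tail m} φ).contDiff.differentiable (by simp)) x

theorem contDiff_eval {n : ℕ} (p : MvPolynomial (Fin n) ℝ) :
    ContDiff ℝ ∞ (fun x : Fin n → ℝ => MvPolynomial.eval x p) := by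
  induction p using MvPolynomial.induction_on with
  | C a => simpa using contDiff_const
  | add p q hp hq => simpa using hp.add hq
  | mul_X p i hp => simpa using hp.mul (contDiff_apply ℝ ℝ i)

theorem fderiv_eval_single {n : ℕ} (p : MvPolynomial (Fin n) ℝ) (i : Fin n) (x : Fin n → ℝ) :
    fderiv ℝ (fun x : Fin n → ℝ => MvPolynomial.eval x p) x (Pi.single i 1) =
      MvPolynomial.eval x (MvPolynomial.pderiv i p) := by
  induction p using MvPolynomial.induction_on with
  | C a => simp
  | add p q hp hq =>
    have h1 := ((contDiff_eval p).differentiable (by simp)) x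
    have h2 := ((contDiff_eval q).differentiable (by simp)) x
    simp only [map_add, ← hp, ← hq]
    rw [fderiv_fun_add h1 h2]
    rfl
  | mul_X p j hp =>
    have h1 := ((contDiff_eval p).differentiable (by simp)) x
    have h2 : HasFDerivAt (fun x : Fin n → ℝ => x j)
        (ContinuousLinearMap.proj (R := ℝ) (φ := fun _ : Fin n => ℝ) j) x :=
      (ContinuousLinearMap.proj (R := ℝ) (φ := fun _ : Fin n => ℝ) j).hasFDerivAt
    simp only [map_mul, MvPolynomial.eval_X, Derivation.leibniz, map_add, smul_eq_mul,
      MvPolynomial.pderiv_X, ← hp]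
    rw [fderiv_fun_mul h1 h2.differentiableAt, h2.fderiv]
    rcases eq_or_ne j i with rfl | h
    · simp
    · simp [h]

theorem mixedDeriv_eval {n : ℕ} (p : MvPolynomial (Fin n) ℝ) :
    mixedDeriv (fun x : Fin n → ℝ => MvPolynomial.eval x p) =
      fun x => MvPolynomial.eval x (mixedPartial p) := by
  unfold mixedDeriv mixedPartial
  rw [List.ofFn_eq_map]
  induction List.finRange n with
  | nil => rfl
  | cons i l ih =>
    ext x
    rw [List.map_cons, dirDeriv_cons, ih, List.foldr_cons]
    exact fderiv_eval_single _ i x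

theorem contDiff_mixedDeriv {n : ℕ} {g : (Fin n → ℝ) → ℝ} (hg : ContDiff ℝ ∞ g) :
    ContDiff ℝ ∞ (mixedDeriv g) := contDiff_dirDeriv hg _

theorem continuous_mixedDeriv {n : ℕ} {g : (Fin n → ℝ) → ℝ} (hg : ContDiff ℝ ∞ g) :
    Continuous (mixedDeriv g) := (contDiff_mixedDeriv hg).continuous

/-! ### Integrals of mixed derivatives over boxes. -/

/-- The embedding of a coordinate hyperplane orthogonal to the first axis. -/
noncomputable def consZeroL (n : ℕ) : (Fin n → ℝ) →L[ℝ] (Fin (n + 1) → ℝ) :=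
  LinearMap.toContinuousLinearMap
    { toFun := fun y => Fin.cons 0 y
      map_add' := fun y z => by
        ext i; refine Fin.cases ?_ (fun i => ?_) i <;> simp
      map_smul' := fun c y => by
        ext i; refine Fin.cases ?_ (fun i => ?_) i <;> simp }

theorem consZeroL_apply {n : ℕ} (y : Fin n → ℝ) : consZeroL n y = Fin.cons 0 y := rfl

theorem cons_eq_add_consZeroL {n : ℕ} (c : ℝ) (y : Fin n → ℝ) :
    (Fin.cons c y : Fin (n + 1) → ℝ) = Fin.cons c 0 + consZeroL n y := by
  ext i
  rw [consZeroL_apply]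
  refine Fin.cases ?_ (fun i => ?_) i <;> simp

/-- Restriction to a face orthogonal to the first axis commutes with differentiation in the
remaining directions; this is what makes induction on the dimension possible. -/
theorem mixedDeriv_cons {n : ℕ} {g : (Fin (n + 1) → ℝ) → ℝ} (hg : ContDiff ℝ ∞ g) (c : ℝ)
    (y : Fin n → ℝ) :
    mixedDeriv (fun y : Fin n → ℝ => g (Fin.cons c y)) y =
      dirDeriv (List.ofFn fun i : Fin n => (Pi.single i.succ 1 : Fin (n + 1) → ℝ)) g
        (Fin.cons c y) := by
  unfold mixedDeriv
  rw [funext fun y => congrArg g (cons_eq_add_consZeroL c y), cons_eq_add_consZeroL c y,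
    dirDeriv_comp_affine hg, List.map_ofFn]
  have h : (consZeroL n ∘ fun i : Fin n => (Pi.single i 1 : Fin n → ℝ)) =
      fun i => Pi.single i.succ 1 := by
    ext i j
    rw [Function.comp_apply, consZeroL_apply]
    refine Fin.cases ?_ (fun j => ?_) j
    · simp [(Fin.succ_ne_zero i).symm]
    · simp [Pi.single_apply]
  rw [h]

theorem contDiff_cons_comp {n : ℕ} {g : (Fin (n + 1) → ℝ) → ℝ} (hg : ContDiff ℝ ∞ g) (c : ℝ) :
    ContDiff ℝ ∞ (fun y : Fin n → ℝ => g (Fin.cons c y)) := by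
  rw [funext fun y => congrArg g (cons_eq_add_consZeroL c y)]
  exact hg.comp (contDiff_const.add (consZeroL n).contDiff)

/-- The divergence theorem for the vector field `(ψ, 0, …, 0)`: only the two faces orthogonal to the
first axis contribute. -/
theorem setIntegral_Icc_fderiv_single_zero {n : ℕ} {ψ : (Fin (n + 1) → ℝ) → ℝ}
    (hψ : ContDiff ℝ ∞ ψ) {a b : Fin (n + 1) → ℝ} (hab : a ≤ b) :
    ∫ x in Set.Icc a b, fderiv ℝ ψ x (Pi.single 0 1) =
      (∫ y in Set.Icc (Fin.tail a) (Fin.tail b), ψ (Fin.cons (b 0) y)) -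
        ∫ y in Set.Icc (Fin.tail a) (Fin.tail b), ψ (Fin.cons (a 0) y) := by
  have hd : ∀ x, HasFDerivAt ψ (fderiv ℝ ψ x) x := fun x =>
    (hψ.differentiable (by simp) x).hasFDerivAt
  have hc : Continuous fun x => fderiv ℝ ψ x (Pi.single 0 1) :=
    ((hψ.fderiv_right (m := ∞) (by norm_cast)).clm_apply contDiff_const).continuous
  have key := integral_divergence_of_hasFDerivAt_off_countable' a b hab
    (fun i => if i = 0 then ψ else 0) (fun i => if i = 0 then fderiv ℝ ψ else 0) ∅
    Set.countable_empty
    (fun i => by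
      split_ifs
      · exact hψ.continuous.continuousOn
      · exact continuousOn_const)
    (fun x _ i => by
      split_ifs
      · exact hd x
      · exact hasFDerivAt_const _ _)
    (by
      have : (fun x => ∑ i : Fin (n + 1),
          (if i = 0 then fderiv ℝ ψ else 0) x (Pi.single i (1 : ℝ))) =
          fun x => fderiv ℝ ψ x (Pi.single 0 1) := by
        ext x
        simp [Fin.sum_univ_succ]
      rw [this]
      exact hc.continuousOn.integrableOn_compact isCompact_Icc)
  simp only [Fin.sum_univ_succ, if_true, Fin.succ_ne_zero, if_false, Pi.zero_apply,
    zero_apply, Finset.sum_const_zero, add_zero, integral_zero,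
    sub_zero] at key
  rw [key]
  simp only [Fin.insertNth_zero]
  rfl

/-- Integrating a mixed partial derivative over a box yields an alternating sum of the values
at the vertices; this is the resulting bound. -/
theorem abs_setIntegral_Icc_mixedDeriv_le {n : ℕ} {g : (Fin n → ℝ) → ℝ} (hg : ContDiff ℝ ∞ g)
    {a b : Fin n → ℝ} (hab : a ≤ b) {C : ℝ} (hC : ∀ x ∈ Set.Icc a b, |g x| ≤ C) :
    |∫ x in Set.Icc a b, mixedDeriv g x| ≤ 2 ^ n * C := by
  induction n with
  | zero =>
    have : Set.Icc a b = Set.univ := Set.eq_univ_of_forall fun x =>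
      ⟨(Subsingleton.elim a x).le, (Subsingleton.elim x b).le⟩
    have h2 : (volume : Measure (Fin 0 → ℝ)) = Measure.dirac a := by
      rw [volume_pi]; exact Measure.pi_of_empty _ _
    rw [this, Measure.restrict_univ, h2, integral_dirac]
    simpa [mixedDeriv, dirDeriv_nil] using hC a ⟨le_rfl, hab⟩
  | succ n ih =>
    have htail : Fin.tail a ≤ Fin.tail b := fun i => hab i.succ
    have hface : ∀ c ∈ Set.Icc (a 0) (b 0),
        |∫ y in Set.Icc (Fin.tail a) (Fin.tail b),
          dirDeriv (List.ofFn fun i : Fin n => (Pi.single i.succ 1 : Fin (n + 1) → ℝ)) g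
            (Fin.cons c y)| ≤ 2 ^ n * C := by
      intro c hc
      simp only [← mixedDeriv_cons hg c]
      refine ih (contDiff_cons_comp hg c) htail fun y hy => hC _ ⟨?_, ?_⟩
      · intro i
        refine Fin.cases ?_ (fun i => ?_) i
        · exact hc.1
        · exact hy.1 i
      · intro i
        refine Fin.cases ?_ (fun i => ?_) i
        · exact hc.2
        · exact hy.2 i
    unfold mixedDeriv
    rw [List.ofFn_succ, dirDeriv_cons,
      setIntegral_Icc_fderiv_single_zero (contDiff_dirDeriv hg _) hab]
    refine (abs_sub _ _).trans ?_
    have h1 := hface (b 0) ⟨hab 0, le_rfl⟩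
    have h2 := hface (a 0) ⟨le_rfl, hab 0⟩
    rw [pow_succ]
    linarith

/-! ### Bernstein expansions and discretization of functionals. -/

section BernsteinForm

/-- The identity `C(N,k) C(k,a) = C(N,a) C(N-a,k-a)` extracts `C(N,a) x^a`, leaving the binomial
expansion of `(x + y)^(N-a) = 1`. -/
theorem sum_choose_mul_choose_mul_pow {R : Type*} [CommRing R] {x y : R} (hxy : x + y = 1)
    {a N : ℕ} (ha : a ≤ N) :
    ∑ k ∈ Finset.range (N + 1), ((N.choose k * k.choose a : ℕ) : R) * (x ^ k * y ^ (N - k)) =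
      (N.choose a : R) * x ^ a := by
  obtain ⟨m, rfl⟩ := Nat.exists_eq_add_of_le ha
  rw [add_assoc, Finset.sum_range_add, Finset.sum_eq_zero, zero_add]
  · have h : ∀ j, (((a + m).choose (a + j) * (a + j).choose a : ℕ) : R) *
        (x ^ (a + j) * y ^ (a + m - (a + j))) =
        ((a + m).choose a : R) * x ^ a * (x ^ j * y ^ (m - j) * (m.choose j : R)) := by
      intro j
      rw [Nat.choose_mul (Nat.le_add_right a j), Nat.add_sub_cancel_left, Nat.add_sub_cancel_left,
        Nat.add_sub_add_left, pow_add]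
      push_cast
      ring
    simp only [h]
    rw [← Finset.mul_sum, ← add_pow, hxy, one_pow, mul_one]
  · intro k hk
    rw [Nat.choose_eq_zero_of_lt (Finset.mem_range.1 hk)]
    simp

/-- The coefficient of `x^a` with respect to the Bernstein polynomials of degree `N`. -/
noncomputable def bernsteinCoeff (N k a : ℕ) : ℝ := (k.choose a : ℝ) / (N.choose a : ℝ)

theorem bernsteinCoeff_nonneg (N k a : ℕ) : 0 ≤ bernsteinCoeff N k a := by
  unfold bernsteinCoeff; positivity

theorem bernsteinCoeff_le_one {N k : ℕ} (a : ℕ) (hk : k ≤ N) : bernsteinCoeff N k a ≤ 1 :=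
  div_le_one_of_le₀ (by exact_mod_cast Nat.choose_le_choose a hk) (by positivity)

theorem bernsteinCoeff_succ {N k a : ℕ} (ha : a < N) :
    bernsteinCoeff N k (a + 1) = bernsteinCoeff N k a * (((k : ℝ) - a) / ((N : ℝ) - a)) := by
  have h : ∀ m : ℕ, (m.choose (a + 1) : ℝ) * (a + 1) = m.choose a * ((m : ℝ) - a) := by
    intro m
    rcases le_or_gt a m with h | h
    · have := Nat.choose_succ_right_eq m a
      rw [← Nat.cast_sub h]
      exact_mod_cast this
    · rw [Nat.choose_eq_zero_of_lt h, Nat.choose_eq_zero_of_lt (h.trans (Nat.lt_succ_self a))]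
      simp
  have hN : (N.choose a : ℝ) ≠ 0 := by exact_mod_cast (Nat.choose_pos ha.le).ne'
  have hN' : (N.choose (a + 1) : ℝ) ≠ 0 := by exact_mod_cast (Nat.choose_pos ha).ne'
  have hNa : (N : ℝ) - a ≠ 0 := sub_ne_zero.2 (by exact_mod_cast ha.ne')
  have ha1 : (a : ℝ) + 1 ≠ 0 := by positivity
  unfold bernsteinCoeff
  rw [div_mul_div_comm, ← h k, ← h N, mul_div_mul_right _ _ ha1]

/-- Raising `a` by one multiplies the coefficient by `(k - a)/(N - a)`, which differs from `k/N` by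
at most `a/(N - a)`. This tends to 0 uniformly in `k`, so induction on `a` applies. -/
theorem eventually_abs_bernsteinCoeff_sub_le (a : ℕ) {ε : ℝ} (hε : 0 < ε) :
    ∀ᶠ N : ℕ in atTop, ∀ k ≤ N, |bernsteinCoeff N k a - ((k : ℝ) / N) ^ a| ≤ ε := by
  induction a generalizing ε with
  | zero => exact Eventually.of_forall fun N k _ => by simpa [bernsteinCoeff] using hε.le
  | succ a ih =>
    have hlim : Tendsto (fun N : ℕ => (a : ℝ) / ((N : ℝ) - a)) atTop (nhds 0) :=
      Tendsto.const_div_atTop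
        (tendsto_atTop_add_const_right _ (-(a : ℝ)) tendsto_natCast_atTop_atTop) _
    filter_upwards [ih (half_pos hε), hlim.eventually (ge_mem_nhds (half_pos hε)),
      eventually_gt_atTop a] with N h1 h2 haN k hk
    have hN : (0 : ℝ) < N := by exact_mod_cast (Nat.zero_le a).trans_lt haN
    have hNa : (0 : ℝ) < (N : ℝ) - a := sub_pos.2 (by exact_mod_cast haN)
    have hkN : (k : ℝ) ≤ N := by exact_mod_cast hk
    have hz0 : 0 ≤ (k : ℝ) / N := by positivity
    have hz1 : (k : ℝ) / N ≤ 1 := div_le_one_of_le₀ hkN hN.le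
    have hv : |((k : ℝ) - a) / ((N : ℝ) - a) - k / N| ≤ a / ((N : ℝ) - a) := by
      have : ((k : ℝ) - a) / ((N : ℝ) - a) - k / N = -((a / ((N : ℝ) - a)) * (1 - k / N)) := by
        field_simp
        ring
      rw [this, abs_neg, abs_of_nonneg (by
        refine mul_nonneg ?_ (by linarith)
        positivity)]
      exact mul_le_of_le_one_right (by positivity) (by linarith)
    rw [bernsteinCoeff_succ haN, pow_succ]
    have hsplit : bernsteinCoeff N k a * (((k : ℝ) - a) / ((N : ℝ) - a)) -
        ((k : ℝ) / N) ^ a * (k / N) =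
        bernsteinCoeff N k a * (((k : ℝ) - a) / ((N : ℝ) - a) - k / N) +
        (bernsteinCoeff N k a - ((k : ℝ) / N) ^ a) * (k / N) := by ring
    rw [hsplit]
    refine (abs_add_le _ _).trans ?_
    rw [abs_mul, abs_mul, abs_of_nonneg hz0, abs_of_nonneg (bernsteinCoeff_nonneg N k a)]
    have h3 := mul_le_of_le_one_left (abs_nonneg (((k : ℝ) - a) / ((N : ℝ) - a) - k / N))
      (bernsteinCoeff_le_one a hk)
    have h4 := mul_le_of_le_one_right (abs_nonneg (bernsteinCoeff N k a - ((k : ℝ) / N) ^ a)) hz1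
    have h5 := h1 k hk
    linarith

theorem abs_prod_sub_prod_le_sum {ι : Type*} (s : Finset ι) {u v : ι → ℝ}
    (hu0 : ∀ i ∈ s, 0 ≤ u i) (hu1 : ∀ i ∈ s, u i ≤ 1)
    (hv0 : ∀ i ∈ s, 0 ≤ v i) (hv1 : ∀ i ∈ s, v i ≤ 1) :
    |∏ i ∈ s, u i - ∏ i ∈ s, v i| ≤ ∑ i ∈ s, |u i - v i| := by
  classical
  induction s using Finset.induction_on with
  | empty => simp
  | insert i s hi ih =>
    rw [Finset.prod_insert hi, Finset.prod_insert hi, Finset.sum_insert hi]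
    have hs := Finset.subset_insert i s
    have h1 := ih (fun j hj => hu0 j (hs hj)) (fun j hj => hu1 j (hs hj))
      (fun j hj => hv0 j (hs hj)) (fun j hj => hv1 j (hs hj))
    have hi' := Finset.mem_insert_self i s
    have h2 : 0 ≤ ∏ j ∈ s, v j := Finset.prod_nonneg fun j hj => hv0 j (hs hj)
    have h3 : ∏ j ∈ s, v j ≤ 1 := Finset.prod_le_one (fun j hj => hv0 j (hs hj))
      fun j hj => hv1 j (hs hj)
    have hsplit : u i * ∏ j ∈ s, u j - v i * ∏ j ∈ s, v j =
        (u i - v i) * ∏ j ∈ s, v j + u i * (∏ j ∈ s, u j - ∏ j ∈ s, v j) := by ring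
    rw [hsplit]
    refine (abs_add_le _ _).trans ?_
    rw [abs_mul, abs_mul, abs_of_nonneg h2, abs_of_nonneg (hu0 i hi')]
    have h4 := mul_le_of_le_one_right (abs_nonneg (u i - v i)) h3
    have h5 := mul_le_of_le_one_left (abs_nonneg (∏ j ∈ s, u j - ∏ j ∈ s, v j)) (hu1 i hi')
    linarith

variable {n : ℕ}

/-- The multi-indices `k` with `k_i ≤ N`. -/
def gridIndex (n N : ℕ) : Finset (Fin n → ℕ) :=
  Fintype.piFinset fun _ => Finset.range (N + 1)

theorem mem_gridIndex {N : ℕ} {k : Fin n → ℕ} : k ∈ gridIndex n N ↔ ∀ i, k i ≤ N := by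
  simp [gridIndex, Fintype.mem_piFinset]

/-- The grid point `k / N`. -/
noncomputable def gridPoint (N : ℕ) (k : Fin n → ℕ) : Fin n → ℝ := fun i => (k i : ℝ) / N

theorem gridPoint_mem {N : ℕ} {k : Fin n → ℕ} (hk : k ∈ gridIndex n N) :
    gridPoint N k ∈ unitCube n := by
  rw [mem_gridIndex] at hk
  refine ⟨fun i => ?_, fun i => ?_⟩
  · unfold gridPoint
    simp only [Pi.zero_apply]
    positivity
  · exact div_le_one_of_le₀ (Nat.cast_le.2 (hk i)) (by positivity)

/-- The Bernstein basis polynomial of multi-degree `(N, …, N)`. -/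
noncomputable def bernsteinBasis (N : ℕ) (k : Fin n → ℕ) : MvPolynomial (Fin n) ℝ :=
  (∏ i, (N.choose (k i) : ℝ)) • bernsteinProd k (fun i => N - k i)

theorem prod_X_pow_eq_sum_bernsteinBasis {N : ℕ} {α : Fin n → ℕ} (hα : ∀ i, α i ≤ N) :
    ∏ i, (MvPolynomial.X i : MvPolynomial (Fin n) ℝ) ^ α i =
      ∑ k ∈ gridIndex n N, (∏ i, bernsteinCoeff N (k i) (α i)) • bernsteinBasis N k := by
  have h1 : ∀ i, (MvPolynomial.X i : MvPolynomial (Fin n) ℝ) ^ α i =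
      ∑ k ∈ Finset.range (N + 1), MvPolynomial.C (bernsteinCoeff N k (α i) * (N.choose k : ℝ)) *
        (MvPolynomial.X i ^ k * (1 - MvPolynomial.X i) ^ (N - k)) := by
    intro i
    have h := sum_choose_mul_choose_mul_pow
      (show (MvPolynomial.X i : MvPolynomial (Fin n) ℝ) + (1 - MvPolynomial.X i) = 1 by ring)
      (hα i)
    have hN : (N.choose (α i) : ℝ) ≠ 0 := by exact_mod_cast (Nat.choose_pos (hα i)).ne'
    have h' := congrArg (fun q => MvPolynomial.C ((N.choose (α i) : ℝ)⁻¹) * q) h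
    simp only [Finset.mul_sum, ← mul_assoc] at h'
    rw [← MvPolynomial.C_eq_coe_nat (N.choose (α i)), ← MvPolynomial.C_mul, inv_mul_cancel₀ hN,
      MvPolynomial.C_1, one_mul] at h'
    rw [← h']
    refine Finset.sum_congr rfl fun k _ => ?_
    rw [← MvPolynomial.C_eq_coe_nat, ← MvPolynomial.C_mul, ← mul_assoc]
    congr 3
    unfold bernsteinCoeff
    push_cast
    ring_nf
  rw [Finset.prod_congr rfl fun i _ => h1 i, Finset.prod_univ_sum]
  refine Finset.sum_congr rfl fun k _ => ?_
  rw [bernsteinBasis, smul_smul, ← Finset.prod_mul_distrib, Finset.prod_mul_distrib,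
    Finset.prod_mul_distrib, ← map_prod, MvPolynomial.C_mul', bernsteinProd]

/-- Every polynomial `p` is, for large `N`, a combination of the Bernstein polynomials of
degree `N` with coefficients uniformly close to the values of `p` on the grid. -/
theorem eventually_exists_bernstein_form (p : MvPolynomial (Fin n) ℝ) {ε : ℝ} (hε : 0 < ε) :
    ∀ᶠ N : ℕ in atTop, ∃ b : (Fin n → ℕ) → ℝ,
      (∀ k ∈ gridIndex n N, |b k - MvPolynomial.eval (gridPoint N k) p| ≤ ε) ∧
      p = ∑ k ∈ gridIndex n N, b k • bernsteinBasis N k := by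
  induction p using MvPolynomial.induction_on' generalizing ε with
  | monomial α c =>
    -- The errors of the `n` factors add up and are scaled by `|c|`; the `+ 1`s keep the denominator
    -- positive.
    have hδ : 0 < ε / ((|c| + 1) * (n + 1)) := by positivity
    have h1 : ∀ᶠ N : ℕ in atTop, ∀ i, ∀ k ≤ N,
        |bernsteinCoeff N k (α i) - ((k : ℝ) / N) ^ α i| ≤ ε / ((|c| + 1) * (n + 1)) :=
      eventually_all.2 fun i => eventually_abs_bernsteinCoeff_sub_le (α i) hδ
    have h2 : ∀ᶠ N : ℕ in atTop, ∀ i, α i ≤ N := eventually_all.2 fun i => eventually_ge_atTop _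
    filter_upwards [h1, h2] with N h1 h2
    refine ⟨fun k => c * ∏ i, bernsteinCoeff N (k i) (α i), fun k hk => ?_, ?_⟩
    · have hk0 := gridPoint_mem hk
      rw [mem_gridIndex] at hk
      rw [MvPolynomial.eval_monomial, Finsupp.prod_fintype _ _ (fun i => pow_zero _), ← mul_sub,
        abs_mul]
      have h3 := abs_prod_sub_prod_le_sum Finset.univ
        (u := fun i => bernsteinCoeff N (k i) (α i)) (v := fun i => gridPoint N k i ^ α i)
        (fun i _ => bernsteinCoeff_nonneg _ _ _) (fun i _ => bernsteinCoeff_le_one _ (hk i))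
        (fun i _ => pow_nonneg (hk0.1 i) _) (fun i _ => pow_le_one₀ (hk0.1 i) (hk0.2 i))
      have h4 : ∑ i, |bernsteinCoeff N (k i) (α i) - gridPoint N k i ^ α i| ≤
          n * (ε / ((|c| + 1) * (n + 1))) := by
        refine (Finset.sum_le_sum fun i _ => h1 i (k i) (hk i)).trans ?_
        simp
      refine (mul_le_mul_of_nonneg_left (h3.trans h4) (abs_nonneg c)).trans ?_
      have : |c| * (n * (ε / ((|c| + 1) * (n + 1)))) = (|c| * n) * ε / ((|c| + 1) * (n + 1)) := by
        ring
      rw [this, div_le_iff₀ (by positivity)]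
      nlinarith [mul_nonneg (abs_nonneg c) hε.le, mul_nonneg (Nat.cast_nonneg (α := ℝ) n) hε.le]
    · rw [MvPolynomial.monomial_eq, Finsupp.prod_fintype _ _ (fun i => pow_zero _),
        prod_X_pow_eq_sum_bernsteinBasis h2, MvPolynomial.C_mul', Finset.smul_sum]
      exact Finset.sum_congr rfl fun k _ => by rw [smul_smul]
  | add p q hp hq =>
    filter_upwards [hp (half_pos hε), hq (half_pos hε)] with N ⟨b, hb, hb'⟩ ⟨c, hc, hc'⟩
    refine ⟨b + c, fun k hk => ?_, ?_⟩
    · have h1 := hb k hk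
      have h2 := hc k hk
      rw [map_add, Pi.add_apply, add_sub_add_comm]
      refine (abs_add_le _ _).trans ?_
      linarith
    · conv_lhs => rw [hb', hc']
      rw [← Finset.sum_add_distrib]
      exact Finset.sum_congr rfl fun k _ => by rw [Pi.add_apply, add_smul]

/-- A linear functional applied to `p` is the limit of the discretizations
`∑ p(k/N) L(B_{N,k})` provided the Bernstein sums are bounded. -/
theorem tendsto_sum_eval_gridPoint_mul (L : MvPolynomial (Fin n) ℝ →ₗ[ℝ] ℝ) {C : ℝ}
    (hC : ∀ N : ℕ, ∑ k ∈ gridIndex n N, |L (bernsteinBasis N k)| ≤ C)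
    (p : MvPolynomial (Fin n) ℝ) :
    Tendsto (fun N : ℕ => ∑ k ∈ gridIndex n N,
      MvPolynomial.eval (gridPoint N k) p * L (bernsteinBasis N k)) atTop (nhds (L p)) := by
  have hC0 : 0 ≤ C := (Finset.sum_nonneg fun _ _ => abs_nonneg _).trans (hC 0)
  rw [Metric.tendsto_nhds]
  intro ε hε
  have hδ : 0 < ε / (C + 1) := by positivity
  filter_upwards [eventually_exists_bernstein_form p hδ] with N ⟨b, hb, hp⟩
  have : L p = ∑ k ∈ gridIndex n N, b k * L (bernsteinBasis N k) := by
    conv_lhs => rw [hp]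
    simp
  rw [dist_comm, this, Real.dist_eq, ← Finset.sum_sub_distrib]
  calc _ ≤ ∑ k ∈ gridIndex n N, ε / (C + 1) * |L (bernsteinBasis N k)| := by
        refine (Finset.abs_sum_le_sum_abs _ _).trans (Finset.sum_le_sum fun k hk => ?_)
        rw [← sub_mul, abs_mul]
        exact mul_le_mul_of_nonneg_right (hb k hk) (abs_nonneg _)
    _ ≤ ε / (C + 1) * C := by
        rw [← Finset.mul_sum]
        exact mul_le_mul_of_nonneg_left (hC N) hδ.le
    _ < ε := by
        rw [div_mul_eq_mul_div, div_lt_iff₀ (by positivity)]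
        nlinarith

end BernsteinForm

/-! ### Representing measures and positivity of functionals. -/

section Representation

variable {n : ℕ}

instance : CompactSpace (unitCube n) := isCompact_iff_compactSpace.1 isCompact_Icc

open CompactlySupported in
/-- Discrete positive measures on the grids of bounded mass have a weak limit along an
ultrafilter. -/
theorem exists_measure_tendsto_hyperfilter {w : ℕ → (Fin n → ℕ) → ℝ} (hw : ∀ N k, 0 ≤ w N k)
    {C : ℝ} (hC : ∀ N, ∑ k ∈ gridIndex n N, w N k ≤ C) :
    ∃ μ : Measure (Fin n → ℝ), IsFiniteMeasure μ ∧ μ (unitCube n)ᶜ = 0 ∧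
      ∀ g : (Fin n → ℝ) → ℝ, Continuous g →
        Tendsto (fun N => ∑ k ∈ gridIndex n N, g (gridPoint N k) * w N k)
          (hyperfilter ℕ : Filter ℕ) (nhds (∫ x, g x ∂μ)) := by
  let T : C_c(unitCube n, ℝ) → ℕ → ℝ := fun g N =>
    ∑ k ∈ (gridIndex n N).attach, g ⟨gridPoint N k, gridPoint_mem k.2⟩ * w N k
  have hbound : ∀ g : C_c(unitCube n, ℝ), ∃ l, Tendsto (T g) (hyperfilter ℕ : Filter ℕ) (nhds l) := by
    intro g
    obtain ⟨M, hM⟩ := (isCompact_range g.continuous).isBounded.exists_norm_le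
    have hM' : ∀ x, |g x| ≤ M := fun x => hM _ ⟨x, rfl⟩
    have hmem : ∀ N, T g N ∈ Set.Icc (-(M * C)) (M * C) := by
      intro N
      rw [Set.mem_Icc, ← abs_le]
      have hM0 : 0 ≤ M :=
        (abs_nonneg _).trans (hM' ⟨0, ⟨le_rfl, fun _ => zero_le_one⟩⟩)
      calc |T g N| ≤ ∑ k ∈ (gridIndex n N).attach, M * w N k := by
            refine (Finset.abs_sum_le_sum_abs _ _).trans (Finset.sum_le_sum fun k _ => ?_)
            rw [abs_mul, abs_of_nonneg (hw N k)]
            exact mul_le_mul_of_nonneg_right (hM' _) (hw N k)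
        _ = M * ∑ k ∈ gridIndex n N, w N k := by
            rw [← Finset.mul_sum, Finset.sum_attach (gridIndex n N) (w N)]
        _ ≤ M * C := mul_le_mul_of_nonneg_left (hC N) hM0
    -- Along an ultrafilter every bounded sequence converges, so one filter serves all `g` at once
    -- and the limit is linear in `g` without extracting subsequences.
    obtain ⟨l, -, hl⟩ := (isCompact_Icc (a := -(M * C)) (b := M * C)).ultrafilter_le_nhds
      ((hyperfilter ℕ).map (T g))
      (by
        rw [le_principal_iff, Ultrafilter.coe_map]
        exact mem_map.2 (univ_mem' hmem))
    exact ⟨l, hl⟩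
  choose Λ hΛ using hbound
  let Λ' : C_c(unitCube n, ℝ) →ₚ[ℝ] ℝ := PositiveLinearMap.mk₀
    { toFun := Λ
      map_add' := fun f g => by
        refine tendsto_nhds_unique (hΛ (f + g)) (((hΛ f).add (hΛ g)).congr fun N => ?_)
        simp only [T, ← Finset.sum_add_distrib, ← add_mul]
        rfl
      map_smul' := fun c f => by
        refine tendsto_nhds_unique (hΛ (c • f)) (((hΛ f).const_mul c).congr fun N => ?_)
        simp only [T, Finset.mul_sum, ← mul_assoc]
        rfl }
    (fun f hf => ge_of_tendsto' (hΛ f) fun N =>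
      Finset.sum_nonneg fun k _ => mul_nonneg (hf _) (hw N k))
  refine ⟨(RealRMK.rieszMeasure Λ').map Subtype.val, inferInstance, ?_, fun g hg => ?_⟩
  · have hm : MeasurableSet (unitCube n) := isClosed_Icc.measurableSet
    rw [Measure.map_apply measurable_subtype_coe hm.compl]
    convert measure_empty (μ := RealRMK.rieszMeasure Λ')
    ext x
    simp
  · rw [integral_map measurable_subtype_coe.aemeasurable hg.aestronglyMeasurable]
    let g' : C_c(unitCube n, ℝ) :=
      { toFun := fun x => g x
        continuous_toFun := hg.comp continuous_subtype_val
        hasCompactSupport' := HasCompactSupport.of_compactSpace _ }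
    have h1 : ∫ x : unitCube n, g x ∂(RealRMK.rieszMeasure Λ') = Λ g' :=
      RealRMK.integral_rieszMeasure Λ' g'
    rw [h1]
    refine (hΛ g').congr fun N => ?_
    exact Finset.sum_attach (gridIndex n N) fun k => g (gridPoint N k) * w N k

theorem continuous_evalPoint (p : MvPolynomial (Fin n) ℝ) :
    Continuous fun x : Fin n → ℝ => MvPolynomial.eval x p := (contDiff_eval p).continuous

/-- The Hausdorff moment problem for signed measures on the cube. -/
theorem exists_measures_of_sum_abs_bernsteinBasis_le (L : MvPolynomial (Fin n) ℝ →ₗ[ℝ] ℝ) {C : ℝ}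
    (hC : ∀ N : ℕ, ∑ k ∈ gridIndex n N, |L (bernsteinBasis N k)| ≤ C) :
    ∃ μ₁ μ₂ : Measure (Fin n → ℝ), IsFiniteMeasure μ₁ ∧ IsFiniteMeasure μ₂ ∧
      μ₁ (unitCube n)ᶜ = 0 ∧ μ₂ (unitCube n)ᶜ = 0 ∧
      ∀ p : MvPolynomial (Fin n) ℝ,
        L p = (∫ x, MvPolynomial.eval x p ∂μ₁) - ∫ x, MvPolynomial.eval x p ∂μ₂ := by
  obtain ⟨μ₁, h1, h1', h1''⟩ := exists_measure_tendsto_hyperfilter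
    -- Splitting the grid weights into positive and negative parts gives two families of positive
    -- measures, each of mass at most `C`.
    (w := fun N k => (L (bernsteinBasis N k))⁺) (fun _ _ => posPart_nonneg _) (C := C)
    (fun N => (Finset.sum_le_sum fun k _ => by
      rw [← posPart_add_negPart]; exact le_add_of_nonneg_right (negPart_nonneg _)).trans (hC N))
  obtain ⟨μ₂, h2, h2', h2''⟩ := exists_measure_tendsto_hyperfilter
    (w := fun N k => (L (bernsteinBasis N k))⁻) (fun _ _ => negPart_nonneg _) (C := C)
    (fun N => (Finset.sum_le_sum fun k _ => by
      rw [← posPart_add_negPart]; exact le_add_of_nonneg_left (posPart_nonneg _)).trans (hC N))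
  refine ⟨μ₁, μ₂, h1, h2, h1', h2', fun p => ?_⟩
  refine tendsto_nhds_unique
    ((tendsto_sum_eval_gridPoint_mul L hC p).mono_left Nat.hyperfilter_le_atTop)
    (((h1'' _ (continuous_evalPoint p)).sub (h2'' _ (continuous_evalPoint p))).congr fun N => ?_)
  rw [← Finset.sum_sub_distrib]
  refine Finset.sum_congr rfl fun k _ => ?_
  rw [← mul_sub, posPart_sub_negPart]

/-- A functional that is nonnegative on the Bernstein polynomials is nonnegative on all polynomials
that are nonnegative on the cube. -/
theorem nonneg_of_bernsteinProd_nonneg (L : MvPolynomial (Fin n) ℝ →ₗ[ℝ] ℝ)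
    (hL : ∀ k l : Fin n → ℕ, 0 ≤ L (bernsteinProd k l)) {p : MvPolynomial (Fin n) ℝ}
    (hp : ∀ x ∈ unitCube n, 0 ≤ MvPolynomial.eval x p) : 0 ≤ L p := by
  have hB : ∀ N (k : Fin n → ℕ), 0 ≤ L (bernsteinBasis N k) := fun N k => by
    rw [bernsteinBasis, map_smul, smul_eq_mul]
    exact mul_nonneg (Finset.prod_nonneg fun i _ => Nat.cast_nonneg _) (hL _ _)
  have hsum : ∀ N : ℕ, ∑ k ∈ gridIndex n N, |L (bernsteinBasis N k)| ≤ L 1 := by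
    intro N
    -- The case `α = 0` is the partition of unity, so for nonnegative weights the absolute sum is
    -- exactly `L 1`.
    have h := prod_X_pow_eq_sum_bernsteinBasis (n := n) (N := N) (α := fun _ => 0)
      fun _ => Nat.zero_le N
    simp only [pow_zero, Finset.prod_const_one, bernsteinCoeff, Nat.choose_zero_right,
      Nat.cast_one, div_one, one_smul] at h
    rw [h, map_sum]
    exact (Finset.sum_congr rfl fun k _ => abs_of_nonneg (hB N k)).le
  exact ge_of_tendsto' (tendsto_sum_eval_gridPoint_mul L hsum p) fun N =>
    Finset.sum_nonneg fun k hk => mul_nonneg (hp _ (gridPoint_mem hk)) (hB N k)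

theorem sum_abs_bernsteinBasis_eq_bernsteinSum (s : (Fin n →₀ ℕ) → ℝ) (N : ℕ) :
    ∑ k ∈ gridIndex n N, |rieszFunctional s (bernsteinBasis N k)| =
      bernsteinSum s fun _ => N := by
  refine Finset.sum_congr rfl fun k _ => ?_
  rw [bernsteinBasis, map_smul, smul_eq_mul, abs_mul,
    abs_of_nonneg (Finset.prod_nonneg fun i _ => Nat.cast_nonneg _)]

theorem sum_eval_bernsteinProd (d : Fin n → ℕ) (x : Fin n → ℝ) :
    ∑ k ∈ Fintype.piFinset (fun i => Finset.range (d i + 1)), (∏ i, ((d i).choose (k i) : ℝ)) *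
      MvPolynomial.eval x (bernsteinProd k fun i => d i - k i) = 1 := by
  have h : ∀ i, ∑ k ∈ Finset.range (d i + 1),
      ((d i).choose k : ℝ) * (x i ^ k * (1 - x i) ^ (d i - k)) = 1 := by
    intro i
    simpa using sum_choose_mul_choose_mul_pow (show x i + (1 - x i) = 1 by ring)
      (Nat.zero_le (d i))
  have h' := Finset.prod_univ_sum (fun i => Finset.range (d i + 1))
    fun i k => ((d i).choose k : ℝ) * (x i ^ k * (1 - x i) ^ (d i - k))
  rw [Finset.prod_congr rfl fun i _ => h i, Finset.prod_const_one] at h'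
  rw [h']
  refine Finset.sum_congr rfl fun k _ => ?_
  simp [bernsteinProd, Finset.prod_mul_distrib]

theorem eval_bernsteinProd_nonneg (k l : Fin n → ℕ) {x : Fin n → ℝ} (hx : x ∈ unitCube n) :
    0 ≤ MvPolynomial.eval x (bernsteinProd k l) := by
  simp only [bernsteinProd, map_mul, map_prod, map_pow, map_sub, map_one, MvPolynomial.eval_X]
  exact mul_nonneg (Finset.prod_nonneg fun i _ => pow_nonneg (hx.1 i) _)
    (Finset.prod_nonneg fun i _ => pow_nonneg (sub_nonneg.2 (hx.2 i)) _)

theorem measurableSet_unitCube : MeasurableSet (unitCube n) := isClosed_Icc.measurableSet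

theorem isCompact_unitCube : IsCompact (unitCube n) := isCompact_Icc

theorem rieszFunctional_monomial (s : (Fin n →₀ ℕ) → ℝ) (α : Fin n →₀ ℕ) :
    rieszFunctional s (MvPolynomial.monomial α 1) = s α := by
  have := (MvPolynomial.basisMonomials (Fin n) ℝ).constr_basis ℝ s α
  rwa [MvPolynomial.coe_basisMonomials] at this

theorem linearMap_eq_rieszFunctional {s : (Fin n →₀ ℕ) → ℝ}
    {L : MvPolynomial (Fin n) ℝ →ₗ[ℝ] ℝ} (h : ∀ α, L (MvPolynomial.monomial α 1) = s α) :
    L = rieszFunctional s := by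
  refine (MvPolynomial.basisMonomials (Fin n) ℝ).ext fun α => ?_
  rw [MvPolynomial.coe_basisMonomials, h, rieszFunctional_monomial]

/-- `mixedPartial` as a linear map. -/
noncomputable def mixedPartialL (n : ℕ) : MvPolynomial (Fin n) ℝ →ₗ[ℝ] MvPolynomial (Fin n) ℝ :=
  (List.finRange n).foldr (fun i T => (MvPolynomial.pderiv i).toLinearMap ∘ₗ T) LinearMap.id

theorem mixedPartialL_apply (p : MvPolynomial (Fin n) ℝ) : mixedPartialL n p = mixedPartial p := by
  unfold mixedPartialL mixedPartial
  induction List.finRange n with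
  | nil => rfl
  | cons i l ih => simp [ih]

theorem rieszFunctional_mixedDerivSeq (s : (Fin n →₀ ℕ) → ℝ) (p : MvPolynomial (Fin n) ℝ) :
    rieszFunctional (mixedDerivSeq s) p = (-1) ^ n * rieszFunctional s (mixedPartial p) := by
  have h := linearMap_eq_rieszFunctional (s := mixedDerivSeq s)
    (L := ((-1 : ℝ) ^ n) • (rieszFunctional s ∘ₗ mixedPartialL n)) fun α => by
      simp [mixedPartialL_apply, mixedDerivSeq]
  rw [← h]
  simp [mixedPartialL_apply]

theorem rieszFunctional_eq_integral {s : (Fin n →₀ ℕ) → ℝ} {f : (Fin n → ℝ) → ℝ}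
    (hf : IntegrableOn f (unitCube n))
    (hs : ∀ α : Fin n →₀ ℕ, s α = ∫ x in unitCube n, (∏ i, x i ^ α i) * f x)
    (p : MvPolynomial (Fin n) ℝ) :
    rieszFunctional s p = ∫ x in unitCube n, MvPolynomial.eval x p * f x := by
  have hint : ∀ p : MvPolynomial (Fin n) ℝ,
      Integrable (fun x => MvPolynomial.eval x p * f x) (volume.restrict (unitCube n)) := fun p =>
    IntegrableOn.continuousOn_mul (continuous_evalPoint p).continuousOn hf isCompact_unitCube
  have h := linearMap_eq_rieszFunctional (s := s)
    (L := { toFun := fun p => ∫ x in unitCube n, MvPolynomial.eval x p * f x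
            map_add' := fun p q => by
              simp only [map_add, add_mul]
              exact integral_add (hint p) (hint q)
            map_smul' := fun c p => by
              simp only [MvPolynomial.smul_eval, mul_assoc, integral_const_mul, smul_eq_mul,
                RingHom.id_apply] }) fun α => by
      rw [hs α]
      refine integral_congr_ae (Eventually.of_forall fun x => ?_)
      simp [MvPolynomial.eval_monomial, Finsupp.prod_fintype]
  rw [← h]
  rfl

end Representation

/-! ### A regular density has bounded Bernstein sums. -/

section Necessity

variable {n : ℕ}

/-- The domination `hs` may be applied to each Bernstein product, since these are nonnegative on the
cube; with their binomial weights they sum to 1, leaving `∫ h`. It is used with `h = |f|` on the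
cube and with `h = 1` for `μ₁ + μ₂`. -/
theorem bernsteinSum_le_integral {s : (Fin n →₀ ℕ) → ℝ} {ρ : Measure (Fin n → ℝ)}
    (hρ : ∀ᵐ x ∂ρ, x ∈ unitCube n) {h : (Fin n → ℝ) → ℝ} (hh : Integrable h ρ)
    (hs : ∀ p : MvPolynomial (Fin n) ℝ, (∀ x ∈ unitCube n, 0 ≤ MvPolynomial.eval x p) →
      |rieszFunctional s p| ≤ ∫ x, MvPolynomial.eval x p * h x ∂ρ) (d : Fin n → ℕ) :
    bernsteinSum s d ≤ ∫ x, h x ∂ρ := by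
  have hint : ∀ p : MvPolynomial (Fin n) ℝ, Integrable (fun x => MvPolynomial.eval x p * h x) ρ := by
    intro p
    obtain ⟨M, hM⟩ := isCompact_unitCube.exists_bound_of_continuousOn
      (continuous_evalPoint p).continuousOn
    exact hh.bdd_mul (continuous_evalPoint p).aestronglyMeasurable (hρ.mono fun x hx => hM x hx)
  have h1 : bernsteinSum s d ≤
      ∑ k ∈ Fintype.piFinset (fun i => Finset.range (d i + 1)), (∏ i, ((d i).choose (k i) : ℝ)) *
        ∫ x, MvPolynomial.eval x (bernsteinProd k fun i => d i - k i) * h x ∂ρ :=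
    Finset.sum_le_sum fun k _ => mul_le_mul_of_nonneg_left
      (hs _ fun x hx => eval_bernsteinProd_nonneg _ _ hx)
      (Finset.prod_nonneg fun i _ => Nat.cast_nonneg _)
  refine h1.trans_eq ?_
  simp only [← integral_const_mul]
  rw [← integral_finsetSum _ fun k _ => (hint _).const_mul _]
  refine integral_congr_ae (Eventually.of_forall fun x => ?_)
  simp only [← mul_assoc]
  rw [← Finset.sum_mul, sum_eval_bernsteinProd, one_mul]

/-- Every polynomial agrees near the cube with a test function. -/
theorem exists_testFunction_eventuallyEq (p : MvPolynomial (Fin n) ℝ) :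
    ∃ φ : 𝓓((⊤ : TopologicalSpace.Opens (Fin n → ℝ)), ℝ), ∀ x ∈ unitCube n,
      (⇑φ : (Fin n → ℝ) → ℝ) =ᶠ[nhds x] fun x => MvPolynomial.eval x p := by
  -- The cube lies in the closed sup-norm unit ball, hence inside the open ball of radius 2 where
  -- the bump equals 1.
  let χ : ContDiffBump (0 : Fin n → ℝ) := ⟨2, 3, by norm_num, by norm_num⟩
  refine ⟨⟨fun x => χ x * MvPolynomial.eval x p, χ.contDiff.mul (contDiff_eval p),
    χ.hasCompactSupport.mul_right, fun _ _ => trivial⟩, fun x hx => ?_⟩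
  have hx2 : x ∈ Metric.ball (0 : Fin n → ℝ) χ.rIn := by
    rw [mem_ball_zero_iff]
    refine lt_of_le_of_lt ((pi_norm_le_iff_of_nonneg zero_le_one).2 fun i => ?_)
      (by norm_num : (1 : ℝ) < 2)
    rw [Real.norm_eq_abs, abs_of_nonneg (hx.1 i)]
    exact hx.2 i
  filter_upwards [χ.eventuallyEq_one_of_mem_ball hx2] with y hy
  change χ y * MvPolynomial.eval y p = _
  rw [hy, Pi.one_apply, one_mul]

theorem ae_mem_unitCube {μ : Measure (Fin n → ℝ)} (h : μ (unitCube n)ᶜ = 0) :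
    ∀ᵐ x ∂μ, x ∈ unitCube n := h

theorem integrable_of_continuous {μ : Measure (Fin n → ℝ)} [IsFiniteMeasure μ]
    (h : μ (unitCube n)ᶜ = 0) {g : (Fin n → ℝ) → ℝ} (hg : Continuous g) : Integrable g μ := by
  obtain ⟨M, hM⟩ := isCompact_unitCube.exists_bound_of_continuousOn hg.continuousOn
  exact Integrable.of_bound hg.aestronglyMeasurable M ((ae_mem_unitCube h).mono fun x hx => hM x hx)

theorem IsRegularDensity.exists_bernsteinSum_lt {s : (Fin n →₀ ℕ) → ℝ} {f : (Fin n → ℝ) → ℝ}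
    (hf : IsRegularDensity s f) :
    ∃ C : ℝ, 0 < C ∧ ∀ d : Fin n → ℕ,
      bernsteinSum s d < C ∧ bernsteinSum (mixedDerivSeq s) d < C := by
  obtain ⟨μ₁, μ₂, h1, h2, -, -, h1', h2', hμ⟩ := hf.mixedDeriv
  have hriesz := rieszFunctional_eq_integral hf.integrableOn hf.moments
  have hS : ∀ d, bernsteinSum s d ≤ ∫ x in unitCube n, |f x| := by
    refine bernsteinSum_le_integral (ae_restrict_mem measurableSet_unitCube)
      hf.integrableOn.abs fun p hp => ?_
    rw [hriesz]
    refine abs_integral_le_integral_abs.trans_eq ?_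
    refine setIntegral_congr_fun measurableSet_unitCube fun x hx => ?_
    simp only [abs_mul, abs_of_nonneg (hp x hx)]
  have hD : ∀ d, bernsteinSum (mixedDerivSeq s) d ≤ ∫ x, (1 : ℝ) ∂(μ₁ + μ₂) := by
    refine bernsteinSum_le_integral
      (ae_add_measure_iff.2 ⟨ae_mem_unitCube h1', ae_mem_unitCube h2'⟩)
      (integrable_const 1) fun p hp => ?_
    have hint1 := integrable_of_continuous h1' (continuous_evalPoint p)
    have hint2 := integrable_of_continuous h2' (continuous_evalPoint p)
    have hpos1 : 0 ≤ ∫ x, MvPolynomial.eval x p ∂μ₁ :=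
      integral_nonneg_of_ae ((ae_mem_unitCube h1').mono hp)
    have hpos2 : 0 ≤ ∫ x, MvPolynomial.eval x p ∂μ₂ :=
      integral_nonneg_of_ae ((ae_mem_unitCube h2').mono hp)
    obtain ⟨φ, hφ⟩ := exists_testFunction_eventuallyEq p
    have key : rieszFunctional (mixedDerivSeq s) p =
        (∫ x, MvPolynomial.eval x p ∂μ₁) - ∫ x, MvPolynomial.eval x p ∂μ₂ := by
      rw [rieszFunctional_mixedDerivSeq, hriesz,
        integral_congr_ae ((ae_mem_unitCube h1').mono fun x hx => (hφ x hx).eq_of_nhds.symm),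
        integral_congr_ae ((ae_mem_unitCube h2').mono fun x hx => (hφ x hx).eq_of_nhds.symm),
        ← hμ φ]
      congr 1
      refine setIntegral_congr_fun measurableSet_unitCube fun x hx => ?_
      -- Agreement on a neighbourhood of each point of the cube, boundary included, makes the
      -- derivatives agree there too.
      have h3 : dirDeriv _ φ x = CubeMoment.mixedDeriv (fun x => MvPolynomial.eval x p) x :=
        (dirDeriv_congr (hφ x hx) _).eq_of_nhds
      rw [mixedDeriv_eval] at h3
      simp only [iteratedLineDerivOp_eq_dirDeriv, h3]
      ring
    simp only [mul_one]
    rw [key, integral_add_measure hint1 hint2, abs_le]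
    constructor <;> linarith
  refine ⟨max (∫ x in unitCube n, |f x|) (∫ x, (1 : ℝ) ∂(μ₁ + μ₂)) + 1, ?_, fun d => ⟨?_, ?_⟩⟩
  · have : 0 ≤ ∫ x in unitCube n, |f x| := integral_nonneg fun x => abs_nonneg _
    have := le_max_left (∫ x in unitCube n, |f x|) (∫ x, (1 : ℝ) ∂(μ₁ + μ₂))
    linarith
  · exact lt_of_le_of_lt ((hS d).trans (le_max_left _ _)) (lt_add_one _)
  · exact lt_of_le_of_lt ((hD d).trans (le_max_right _ _)) (lt_add_one _)

end Necessity

/-! ### Uniform polynomial approximation on the cube. -/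

section Weierstrass

variable {n : ℕ}

theorem exists_abs_eval_sub_le {g : (Fin n → ℝ) → ℝ} (hg : Continuous g) {ε : ℝ} (hε : 0 < ε) :
    ∃ p : MvPolynomial (Fin n) ℝ, ∀ x ∈ unitCube n, |MvPolynomial.eval x p - g x| ≤ ε := by
  let Φ : MvPolynomial (Fin n) ℝ →ₐ[ℝ] C(Fin n → ℝ, ℝ) :=
    MvPolynomial.aeval fun i => ⟨fun x => x i, continuous_apply i⟩
  have hΦ : ∀ p x, Φ p x = MvPolynomial.eval x p := by
    intro p x
    induction p using MvPolynomial.induction_on with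
    | C a => simp [Φ]
    | add p q hp hq => simp [hp, hq]
    | mul_X p i hp => simp [hp, Φ]
  have hsep : Φ.range.SeparatesPoints := by
    intro x y hxy
    obtain ⟨i, hi⟩ := Function.ne_iff.1 hxy
    exact ⟨_, ⟨Φ (MvPolynomial.X i), ⟨_, rfl⟩, rfl⟩, by simpa [hΦ] using hi⟩
  obtain ⟨_, ⟨p, rfl⟩, hp⟩ :=
    ContinuousMap.exists_mem_subalgebra_near_continuous_of_isCompact_of_separatesPoints
      hsep ⟨g, hg⟩ (isCompact_unitCube (n := n)) hε
  refine ⟨p, fun x hx => ?_⟩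
  have := hp x hx
  simp only [RingHom.coe_coe, AlgHom.toRingHom_eq_coe, hΦ, ContinuousMap.coe_mk,
    Real.norm_eq_abs] at this
  exact this.le

end Weierstrass

/-! ### Nonnegativity of the density. -/

section Nonneg

variable {n : ℕ}

theorem setIntegral_mul_nonneg_of_polynomial {f : (Fin n → ℝ) → ℝ}
    (hf : IntegrableOn f (unitCube n))
    (hpoly : ∀ p : MvPolynomial (Fin n) ℝ, (∀ x ∈ unitCube n, 0 ≤ MvPolynomial.eval x p) →
      0 ≤ ∫ x in unitCube n, MvPolynomial.eval x p * f x)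
    {g : (Fin n → ℝ) → ℝ} (hg : Continuous g) (hg0 : ∀ x, 0 ≤ g x) :
    0 ≤ ∫ x in unitCube n, g x * f x := by
  have hint : ∀ {g : (Fin n → ℝ) → ℝ}, Continuous g → IntegrableOn (fun x => g x * f x) (unitCube n) :=
    fun hg => hf.continuousOn_mul hg.continuousOn isCompact_unitCube
  have hI : 0 ≤ ∫ x in unitCube n, |f x| := integral_nonneg fun x => abs_nonneg _
  refine le_of_forall_pos_le_add fun ε hε => ?_
  have hδ : 0 < ε / (2 * ((∫ x in unitCube n, |f x|) + 1)) := by positivity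
  set δ := ε / (2 * ((∫ x in unitCube n, |f x|) + 1)) with hδ_def
  -- Approximating `g + δ` within `δ` makes `p` nonnegative on the cube while staying within `2δ` of
  -- `g`.
  obtain ⟨p, hp⟩ := exists_abs_eval_sub_le (g := fun x => g x + δ)
    (hg.add continuous_const) hδ
  have h1 := hpoly p fun x hx => by
    have := (abs_le.1 (hp x hx)).1
    have := hg0 x
    linarith
  have h2 : (∫ x in unitCube n, MvPolynomial.eval x p * f x) - ∫ x in unitCube n, g x * f x ≤
      2 * δ * ∫ x in unitCube n, |f x| := by
    rw [← integral_sub (hint (continuous_evalPoint p)) (hint hg), ← integral_const_mul]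
    refine setIntegral_mono_on ((hint (continuous_evalPoint p)).sub (hint hg))
      (hf.abs.const_mul _) measurableSet_unitCube fun x hx => ?_
    rw [← sub_mul]
    refine (le_abs_self _).trans ?_
    rw [abs_mul]
    refine mul_le_mul_of_nonneg_right ?_ (abs_nonneg _)
    have := abs_le.1 (hp x hx)
    rw [abs_le]
    constructor <;> linarith [this.1, this.2]
  have h3 : 2 * δ * ∫ x in unitCube n, |f x| ≤ ε := by
    rw [hδ_def]
    have : 2 * (ε / (2 * ((∫ x in unitCube n, |f x|) + 1))) * (∫ x in unitCube n, |f x|) =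
      (ε * ∫ x in unitCube n, |f x|) / ((∫ x in unitCube n, |f x|) + 1) := by
      field_simp
    rw [this, div_le_iff₀ (by positivity)]
    nlinarith
  linarith

theorem ae_nonneg_of_polynomial {f : (Fin n → ℝ) → ℝ} (hf : IntegrableOn f (unitCube n))
    (hpoly : ∀ p : MvPolynomial (Fin n) ℝ, (∀ x ∈ unitCube n, 0 ≤ MvPolynomial.eval x p) →
      0 ≤ ∫ x in unitCube n, MvPolynomial.eval x p * f x) :
    ∀ᵐ x ∂(volume.restrict (unitCube n)), 0 ≤ f x := by
  refine ae_nonneg_of_forall_setIntegral_nonneg hf fun S hS _ => ?_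
  set ρ := volume.restrict (unitCube n) with hρ
  have hfin : IsFiniteMeasure ρ := ⟨by
    rw [hρ, Measure.restrict_apply_univ]; exact isCompact_unitCube.measure_lt_top⟩
  -- Approximation of `1_S` in `L¹(|f| dx)` bounds `∫ |f| |1_S - g|` directly, although `f` is
  -- merely integrable.
  set ν := ρ.withDensity fun x => ‖f x‖ₑ with hν
  have hνfin : IsFiniteMeasure ν := isFiniteMeasure_withDensity hf.2.ne
  have hνint : ∀ h : (Fin n → ℝ) → ℝ, ∫ x, h x ∂ν = ∫ x, |f x| * h x ∂ρ := by
    intro h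
    rw [hν, integral_withDensity_eq_integral_toReal_smul₀ hf.1.enorm
      (Eventually.of_forall fun x => enorm_lt_top)]
    simp only [toReal_enorm, Real.norm_eq_abs, smul_eq_mul]
    rw [hρ]
  refine le_of_forall_pos_le_add fun ε hε => ?_
  obtain ⟨g, -, hgε, hg, hgint⟩ := Integrable.exists_hasCompactSupport_integral_sub_le
    (μ := ν) (f := S.indicator fun _ => (1 : ℝ)) ((integrable_const 1).indicator hS) hε
  have hbd : Integrable (fun x => f x * (S.indicator (fun _ => (1 : ℝ)) x)) ρ := by
    have := Integrable.indicator (μ := ρ) hf hS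
    refine this.congr (Eventually.of_forall fun x => ?_)
    by_cases hx : x ∈ S <;> simp [hx]
  -- Truncation at 0 makes the approximant admissible and does not increase its distance to the
  -- nonnegative function `1_S`.
  have hgm : Continuous fun x => max (g x) 0 := hg.max continuous_const
  have hgi : Integrable (fun x => max (g x) 0 * f x) ρ :=
    IntegrableOn.continuousOn_mul hgm.continuousOn hf isCompact_unitCube
  have h1 := setIntegral_mul_nonneg_of_polynomial hf hpoly hgm fun x => le_max_right _ _
  have h2 : (∫ x in S, f x ∂ρ) = ∫ x, f x * (S.indicator (fun _ => (1 : ℝ)) x) ∂ρ := by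
    rw [← integral_indicator hS]
    refine integral_congr_ae (Eventually.of_forall fun x => ?_)
    by_cases hx : x ∈ S <;> simp [hx]
  rw [hνint] at hgε
  have hgi' : Integrable (fun x => |f x| * ‖S.indicator (fun _ => (1 : ℝ)) x - g x‖) ρ := by
    have h3 : Integrable (fun x => g x * f x) ρ :=
      IntegrableOn.continuousOn_mul hg.continuousOn hf isCompact_unitCube
    refine (hbd.sub h3).norm.congr (Eventually.of_forall fun x => ?_)
    simp only [Pi.sub_apply, Real.norm_eq_abs]
    rw [← abs_mul, mul_sub, mul_comm (g x)]
  have h4 : (∫ x, max (g x) 0 * f x ∂ρ) - ∫ x, f x * (S.indicator (fun _ => (1 : ℝ)) x) ∂ρ ≤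
      ∫ x, |f x| * ‖S.indicator (fun _ => (1 : ℝ)) x - g x‖ ∂ρ := by
    rw [← integral_sub hgi hbd]
    refine integral_mono (hgi.sub hbd) hgi' fun x => ?_
    have h5 : |max (g x) 0 - S.indicator (fun _ => (1 : ℝ)) x| ≤
        |S.indicator (fun _ => (1 : ℝ)) x - g x| := by
      have h6 : S.indicator (fun _ => (1 : ℝ)) x = max (S.indicator (fun _ => (1 : ℝ)) x) 0 :=
        (max_eq_left (Set.indicator_nonneg (fun _ _ => zero_le_one) x)).symm
      rw [abs_sub_comm _ (g x)]
      conv_lhs => rw [h6]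
      exact abs_max_sub_max_le_abs _ _ _
    calc max (g x) 0 * f x - f x * S.indicator (fun _ => (1 : ℝ)) x
        = f x * (max (g x) 0 - S.indicator (fun _ => (1 : ℝ)) x) := by ring
      _ ≤ |f x| * |max (g x) 0 - S.indicator (fun _ => (1 : ℝ)) x| := by
          rw [← abs_mul]; exact le_abs_self _
      _ ≤ _ := mul_le_mul_of_nonneg_left h5 (abs_nonneg _)
  rw [h2]
  linarith

theorem nonneg_of_continuousWithinAt {f : (Fin n → ℝ) → ℝ}
    (hf : ∀ᵐ x ∂(volume.restrict (unitCube n)), 0 ≤ f x) {x : Fin n → ℝ} (hx : x ∈ unitCube n)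
    (hc : ContinuousWithinAt f (unitCube n) x) : 0 ≤ f x := by
  by_contra! hneg
  obtain ⟨U, hU, hxU, hUf⟩ := mem_nhdsWithin.1 (hc.eventually_lt_const hneg)
  -- Since `x` may lie on the boundary, its neighbourhood is intersected with the open cube, which
  -- is dense in the cube; the result is nonempty and open, hence of positive volume.
  let O : Set (Fin n → ℝ) := Set.pi Set.univ fun _ => Set.Ioo 0 1
  have hO : IsOpen O := isOpen_set_pi Set.finite_univ fun _ _ => isOpen_Ioo
  have hcl : closure O = unitCube n := by
    rw [closure_pi_set, unitCube, ← Set.pi_univ_Icc]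
    refine Set.pi_congr rfl fun i _ => ?_
    exact closure_Ioo zero_ne_one
  have hne : (U ∩ O).Nonempty := mem_closure_iff.1 (hcl ▸ hx) U hU hxU
  have hpos := (hU.inter hO).measure_pos volume hne
  have hsub : U ∩ O ⊆ unitCube n := fun y hy => hcl ▸ subset_closure hy.2
  have hnull : volume (U ∩ O) = 0 := by
    have h1 := (ae_restrict_iff' measurableSet_unitCube).1 hf
    refine measure_mono_null (fun y hy => ?_) h1
    intro h2
    exact absurd (hUf ⟨hy.1, hsub hy⟩) (not_lt.2 (h2 (hsub hy)))
  exact hpos.ne' hnull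

end Nonneg

/-! ### Distribution functions of finite measures. -/

section DistributionFunction

variable {n : ℕ}

/-- For fixed `a` the exceptional `y` lie in finitely many coordinate hyperplanes, which are
Lebesgue null; Fubini exchanges the quantifiers. -/
theorem ae_ae_forall_ne (μ : Measure (Fin n → ℝ)) [IsFiniteMeasure μ] :
    ∀ᵐ y : Fin n → ℝ, ∀ᵐ a ∂μ, ∀ i, a i ≠ y i := by
  have hm : MeasurableSet {z : (Fin n → ℝ) × (Fin n → ℝ) | ∀ i, z.1 i ≠ z.2 i} := by
    rw [Set.ofPred_forall]
    refine MeasurableSet.iInter fun i => ?_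
    exact (measurableSet_eq_fun (f := fun z : (Fin n → ℝ) × (Fin n → ℝ) => z.1 i)
      (g := fun z => z.2 i) (by fun_prop) (by fun_prop)).compl
  refine (Measure.ae_ae_comm hm).1 (Eventually.of_forall fun a => ?_)
  refine ae_all_iff.2 fun i => ?_
  have h := Measure.pi_hyperplane (fun _ : Fin n => (volume : Measure ℝ)) i (a i)
  rw [← volume_pi] at h
  refine measure_mono_null (fun y hy => ?_) h
  have : ¬ (a i ≠ y i) := hy
  exact (not_not.1 this).symm

/-- The distribution function of a finite measure is continuous almost everywhere. -/
theorem ae_continuousAt_measureReal_Iic (μ : Measure (Fin n → ℝ)) [IsFiniteMeasure μ] :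
    ∀ᵐ y : Fin n → ℝ, ContinuousAt (fun y => μ.real (Set.Iic y)) y := by
  filter_upwards [ae_ae_forall_ne μ] with y hy
  have hrw : (fun y => μ.real (Set.Iic y)) =
      fun y => ∫ a, (Set.Iic y).indicator (fun _ => (1 : ℝ)) a ∂μ := by
    ext y
    exact (integral_indicator_one measurableSet_Iic).symm
  rw [hrw]
  -- If no coordinate of `a` equals that of `y`, then `z ↦ 1_{a ≤ z}` is locally constant at `y`;
  -- dominated convergence does the rest.
  refine continuousAt_of_dominated (bound := fun _ => 1)
    (Eventually.of_forall fun z =>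
      (measurable_const.indicator measurableSet_Iic).aestronglyMeasurable)
    (Eventually.of_forall fun z => Eventually.of_forall fun a => ?_) (integrable_const 1) ?_
  · by_cases h : a ∈ Set.Iic z <;> simp [h]
  filter_upwards [hy] with a ha
  by_cases h : a ≤ y
  · have hlt : ∀ i, a i < y i := fun i => lt_of_le_of_ne (h i) (ha i)
    have hev : ∀ᶠ z in nhds y, ∀ i, a i < z i := eventually_all.2 fun i =>
      (continuous_apply i).continuousAt.eventually_const_lt (hlt i)
    refine (continuousAt_const (y := (1 : ℝ))).congr ?_
    filter_upwards [hev] with z hz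
    have : a ∈ Set.Iic z := fun i => (hz i).le
    simp [this]
  · obtain ⟨i, hi⟩ : ∃ i, y i < a i := by
      by_contra! h'
      exact h h'
    have hev : ∀ᶠ z in nhds y, z i < a i :=
      (continuous_apply i).continuousAt.eventually_lt_const hi
    refine (continuousAt_const (y := (0 : ℝ))).congr ?_
    filter_upwards [hev] with z hz
    have : a ∉ Set.Iic z := fun h => absurd (h i) (not_le.2 hz)
    simp [this]

instance : IsFiniteMeasure (volume.restrict (unitCube n)) :=
  ⟨by rw [Measure.restrict_apply_univ]; exact isCompact_unitCube.measure_lt_top⟩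

theorem integrableOn_of_continuous {h : (Fin n → ℝ) → ℝ} (hh : Continuous h) :
    IntegrableOn h (unitCube n) := hh.continuousOn.integrableOn_compact isCompact_unitCube

section Fubini

theorem integrable_indicator_le_mul (μ : Measure (Fin n → ℝ)) [IsFiniteMeasure μ]
    {h : (Fin n → ℝ) → ℝ} (hh : Continuous h) :
    Integrable (fun z : (Fin n → ℝ) × (Fin n → ℝ) =>
      (Set.Iic z.1).indicator (fun _ => (1 : ℝ)) z.2 * h z.1)
      ((volume.restrict (unitCube n)).prod μ) := by
  have h1 : Integrable (fun z : (Fin n → ℝ) × (Fin n → ℝ) => h z.1)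
      ((volume.restrict (unitCube n)).prod μ) :=
    Integrable.comp_fst (integrableOn_of_continuous hh) μ
  have hm : MeasurableSet {z : (Fin n → ℝ) × (Fin n → ℝ) | z.2 ≤ z.1} :=
    (isClosed_le continuous_snd continuous_fst).measurableSet
  refine (h1.indicator hm).congr (Eventually.of_forall fun z => ?_)
  by_cases hz : z.2 ≤ z.1 <;> simp [Set.indicator, hz]

theorem integral_indicator_Iic_mul (μ : Measure (Fin n → ℝ)) (h : (Fin n → ℝ) → ℝ) (y : Fin n → ℝ) :
    ∫ a, (Set.Iic y).indicator (fun _ => (1 : ℝ)) a * h y ∂μ = μ.real (Set.Iic y) * h y := by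
  rw [integral_mul_const]
  congr 1
  exact integral_indicator_one measurableSet_Iic

theorem integrableOn_measureReal_Iic_mul (μ : Measure (Fin n → ℝ)) [IsFiniteMeasure μ]
    {h : (Fin n → ℝ) → ℝ} (hh : Continuous h) :
    IntegrableOn (fun y => μ.real (Set.Iic y) * h y) (unitCube n) := by
  refine (integrable_indicator_le_mul μ hh).integral_prod_left.congr
    (Eventually.of_forall fun y => ?_)
  exact integral_indicator_Iic_mul μ h y

/-- Fubini for the indicator of `a ≤ y`; for `a` in the cube, the `y` in the cube above `a` form the
box `[a, 1]`. -/
theorem setIntegral_measureReal_Iic_mul (μ : Measure (Fin n → ℝ)) [IsFiniteMeasure μ]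
    (hμ : μ (unitCube n)ᶜ = 0) {h : (Fin n → ℝ) → ℝ}
    (hh : Continuous h) :
    ∫ y in unitCube n, μ.real (Set.Iic y) * h y = ∫ a, (∫ y in Set.Icc a 1, h y) ∂μ := by
  simp only [← integral_indicator_Iic_mul μ h]
  rw [integral_integral_swap (integrable_indicator_le_mul μ hh)]
  refine integral_congr_ae ((ae_mem_unitCube hμ).mono fun a ha => ?_)
  have hsub : Set.Icc a 1 = unitCube n ∩ Set.Ici a := by
    ext y
    exact ⟨fun hy => ⟨⟨ha.1.trans hy.1, hy.2⟩, hy.1⟩, fun hy => ⟨hy.2, hy.1.2⟩⟩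
  dsimp only
  rw [hsub, ← setIntegral_indicator measurableSet_Ici]
  refine integral_congr_ae (Eventually.of_forall fun y => ?_)
  by_cases hy : a ≤ y <;> simp [Set.indicator, hy]

/-- The key estimate: although derivatives of `g` are integrated, only the sup norm of `g` enters,
because each inner box integral is a sum of `2^n` signed vertex values. -/
theorem abs_setIntegral_measureReal_Iic_mul_mixedDeriv_le (μ : Measure (Fin n → ℝ)) [IsFiniteMeasure μ]
    (hμ : μ (unitCube n)ᶜ = 0)
    {g : (Fin n → ℝ) → ℝ} (hg : ContDiff ℝ ∞ g) {C : ℝ} (hC : ∀ x ∈ unitCube n, |g x| ≤ C) :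
    |∫ y in unitCube n, μ.real (Set.Iic y) * mixedDeriv g y| ≤ 2 ^ n * C * μ.real Set.univ := by
  rw [setIntegral_measureReal_Iic_mul μ hμ (continuous_mixedDeriv hg)]
  rw [← Real.norm_eq_abs]
  refine norm_integral_le_of_norm_le_const ((ae_mem_unitCube hμ).mono fun a ha => ?_)
  exact abs_setIntegral_Icc_mixedDeriv_le hg ha.2 fun x hx => hC x ⟨ha.1.trans hx.1, hx.2⟩

end Fubini

/-! ### The distribution function as a regular density. -/

theorem setIntegral_Icc_prod_pow {a : Fin n → ℝ} (ha : a ≤ 1) (α : Fin n → ℕ) :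
    ∫ y in Set.Icc a 1, ∏ i, y i ^ α i = ∏ i, ((1 - a i ^ (α i + 1)) / (α i + 1)) := by
  rw [← Set.pi_univ_Icc, volume_pi, Measure.restrict_pi_pi,
    integral_fintype_prod_eq_prod (fun i (t : ℝ) => t ^ α i)]
  refine Finset.prod_congr rfl fun i _ => ?_
  rw [Pi.one_apply, integral_Icc_eq_integral_Ioc, ← intervalIntegral.integral_of_le (show a i ≤ 1 from ha i),
    integral_pow, one_pow]

theorem pderiv_prod_of_pderiv_eq_zero (j : Fin n) (G : Fin n → MvPolynomial (Fin n) ℝ)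
    (hG : ∀ i, i ≠ j → MvPolynomial.pderiv j (G i) = 0) :
    MvPolynomial.pderiv j (∏ i, G i) =
      ∏ i, Function.update G j (MvPolynomial.pderiv j (G j)) i := by
  have h0 : ∀ s : Finset (Fin n), j ∉ s → MvPolynomial.pderiv j (∏ i ∈ s, G i) = 0 := by
    intro s
    induction s using Finset.induction_on with
    | empty => simp
    | insert i s hi ih =>
      intro hj
      rw [Finset.mem_insert, not_or] at hj
      rw [Finset.prod_insert hi, Derivation.leibniz, ih hj.2, hG i (Ne.symm hj.1)]
      simp
  rw [Finset.prod_update_of_mem (Finset.mem_univ j), ← Finset.mul_prod_erase _ _ (Finset.mem_univ j),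
    Derivation.leibniz, h0 _ (Finset.notMem_erase j _), Finset.sdiff_singleton_eq_erase]
  simp [mul_comm]

theorem mixedPartial_prod {A B : Fin n → MvPolynomial (Fin n) ℝ}
    (hA : ∀ i, MvPolynomial.pderiv i (A i) = B i)
    (hA' : ∀ i j, i ≠ j → MvPolynomial.pderiv j (A i) = 0)
    (hB' : ∀ i j, i ≠ j → MvPolynomial.pderiv j (B i) = 0) :
    mixedPartial (∏ i, A i) = ∏ i, B i := by
  have h : ∀ l : List (Fin n), l.Nodup →
      l.foldr (fun i q => MvPolynomial.pderiv i q) (∏ i, A i) =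
        ∏ i, if i ∈ l then B i else A i := by
    intro l
    induction l with
    | nil => simp
    | cons j l ih =>
      intro hl
      rw [List.nodup_cons] at hl
      rw [List.foldr_cons, ih hl.2, pderiv_prod_of_pderiv_eq_zero]
      · refine Finset.prod_congr rfl fun i _ => ?_
        rcases eq_or_ne i j with rfl | hij
        · simp [hl.1, hA]
        · simp [hij]
      · intro i hij
        split_ifs
        · exact hB' i j hij
        · exact hA' i j hij
  rw [mixedPartial, h _ (List.nodup_finRange n)]
  simp

/-- A polynomial with `∂_1 ⋯ ∂_n` equal to `(-1)^n x^α`, vanishing on the upper faces. -/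
theorem exists_mixedPartial_eq (α : Fin n →₀ ℕ) :
    ∃ P : MvPolynomial (Fin n) ℝ,
      mixedPartial P = MvPolynomial.monomial α ((-1) ^ n) ∧
      ∀ a : Fin n → ℝ, MvPolynomial.eval a P = ∏ i, ((1 - a i ^ (α i + 1)) / (α i + 1)) := by
  -- Each factor is `∫_{x_i}^1 t^{α_i} dt`, so `P(a)` equals the integral of `x^α` over `[a, 1]`.
  refine ⟨∏ i, MvPolynomial.C (((α i : ℝ) + 1)⁻¹) * (1 - MvPolynomial.X i ^ (α i + 1)), ?_,
    fun a => ?_⟩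
  · rw [mixedPartial_prod (B := fun i => MvPolynomial.C (-1) * MvPolynomial.X i ^ α i)]
    · rw [Finset.prod_mul_distrib, MvPolynomial.monomial_eq,
        Finsupp.prod_fintype _ _ fun i => pow_zero _]
      simp
    · intro i
      have h : (α i : ℝ) + 1 ≠ 0 := by positivity
      simp only [MvPolynomial.pderiv_C_mul, map_sub, MvPolynomial.pderiv_one,
        MvPolynomial.pderiv_pow, MvPolynomial.pderiv_X_self, zero_sub, mul_one,
        Nat.add_sub_cancel]
      rw [← MvPolynomial.C_eq_coe_nat, mul_neg, ← mul_assoc, ← MvPolynomial.C_mul]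
      push_cast
      rw [inv_mul_cancel₀ h]
      simp
    · intro i j hij
      simp [MvPolynomial.pderiv_X_of_ne hij]
    · intro i j hij
      simp [MvPolynomial.pderiv_X_of_ne hij]
  · simp [map_prod, div_eq_inv_mul]

/-- If `∂_1 ⋯ ∂_n s` is represented by the signed measure `μ₁ - μ₂`, then `s` is the moment
sequence of the distribution function of `μ₁ - μ₂`. -/
theorem isRegularDensity_measureReal_Iic {s : (Fin n →₀ ℕ) → ℝ} {μ₁ μ₂ : Measure (Fin n → ℝ)}
    [IsFiniteMeasure μ₁] [IsFiniteMeasure μ₂]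
    (h1 : μ₁ (unitCube n)ᶜ = 0) (h2 : μ₂ (unitCube n)ᶜ = 0)
    (hs : ∀ p : MvPolynomial (Fin n) ℝ, rieszFunctional (mixedDerivSeq s) p =
      (∫ x, MvPolynomial.eval x p ∂μ₁) - ∫ x, MvPolynomial.eval x p ∂μ₂) :
    IsRegularDensity s fun y => μ₁.real (Set.Iic y) - μ₂.real (Set.Iic y) := by
  have hint : IntegrableOn (fun y => μ₁.real (Set.Iic y) - μ₂.real (Set.Iic y)) (unitCube n) := by
    have := (integrableOn_measureReal_Iic_mul μ₁ (continuous_const (y := (1 : ℝ)))).sub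
      (integrableOn_measureReal_Iic_mul μ₂ (continuous_const (y := (1 : ℝ))))
    simp only [mul_one] at this
    exact this
  have hsplit : ∀ {h : (Fin n → ℝ) → ℝ}, Continuous h →
      ∫ y in unitCube n, (μ₁.real (Set.Iic y) - μ₂.real (Set.Iic y)) * h y =
        (∫ y in unitCube n, μ₁.real (Set.Iic y) * h y) -
          ∫ y in unitCube n, μ₂.real (Set.Iic y) * h y := fun hh => by
    simp only [sub_mul]
    exact integral_sub (integrableOn_measureReal_Iic_mul μ₁ hh)
      (integrableOn_measureReal_Iic_mul μ₂ hh)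
  have hmom : ∀ α : Fin n →₀ ℕ, s α =
      ∫ y in unitCube n, (∏ i, y i ^ α i) * (μ₁.real (Set.Iic y) - μ₂.real (Set.Iic y)) := by
    intro α
    obtain ⟨P, hP, hPe⟩ := exists_mixedPartial_eq α
    have hα : Continuous fun y : Fin n → ℝ => ∏ i, y i ^ α i := by fun_prop
    -- The sign in the definition of `∂s` cancels the `(-1)^n` in `∂_1 ⋯ ∂_n P`.
    have h3 : s α = rieszFunctional (mixedDerivSeq s) P := by
      have : MvPolynomial.monomial α ((-1 : ℝ) ^ n) =
          ((-1 : ℝ) ^ n) • MvPolynomial.monomial α 1 := by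
        rw [MvPolynomial.smul_monomial, smul_eq_mul, mul_one]
      rw [rieszFunctional_mixedDerivSeq, hP, this, map_smul, rieszFunctional_monomial,
        smul_eq_mul, ← mul_assoc, ← mul_pow]
      simp
    have h4 : ∀ (μ : Measure (Fin n → ℝ)) [IsFiniteMeasure μ], μ (unitCube n)ᶜ = 0 →
        ∫ y in unitCube n, μ.real (Set.Iic y) * ∏ i, y i ^ α i =
          ∫ a, MvPolynomial.eval a P ∂μ := by
      intro μ _ hμ
      rw [setIntegral_measureReal_Iic_mul μ hμ hα]
      refine integral_congr_ae ((ae_mem_unitCube hμ).mono fun a ha => ?_)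
      dsimp only
      rw [setIntegral_Icc_prod_pow ha.2, hPe]
    simp only [mul_comm (∏ i, _ ^ α i)]
    rw [hsplit hα, h4 μ₁ h1, h4 μ₂ h2, h3, hs]
  refine ⟨?_, hint, hmom, μ₁, μ₂, inferInstance, inferInstance, inferInstance, inferInstance,
    h1, h2, fun φ => ?_⟩
  · refine ae_restrict_of_ae ?_
    filter_upwards [ae_continuousAt_measureReal_Iic μ₁, ae_continuousAt_measureReal_Iic μ₂]
      with y hy1 hy2
    exact (hy1.sub hy2).continuousWithinAt
  · have hφ : ContDiff ℝ ∞ φ := φ.contDiff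
    have hφ' : ⇑(∂^{fun i : Fin n => (Pi.single i 1 : Fin n → ℝ)} φ) =
        mixedDeriv φ := iteratedLineDerivOp_eq_dirDeriv φ _
    simp only [hφ']
    rw [hsplit (continuous_mixedDeriv hφ), ← sub_eq_zero, ← abs_eq_zero]
    refine le_antisymm (le_of_forall_pos_le_add fun ε hε => ?_) (abs_nonneg _)
    set m₁ := μ₁.real Set.univ with hm₁
    set m₂ := μ₂.real Set.univ with hm₂
    have hm₁0 : 0 ≤ m₁ := measureReal_nonneg
    have hm₂0 : 0 ≤ m₂ := measureReal_nonneg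
    -- Replacing `φ` by a polynomial within `δ` costs `2^n δ` per unit mass on the derivative side
    -- and `δ` per unit mass on the measure side.
    set K : ℝ := (2 ^ n + 1) * (m₁ + m₂) with hK
    have hK0 : 0 ≤ K := by positivity
    have hδ : 0 < ε / (K + 1) := by positivity
    set δ := ε / (K + 1) with hδ_def
    obtain ⟨p, hp⟩ := exists_abs_eval_sub_le φ.continuous hδ
    let q : (Fin n → ℝ) → ℝ := fun x => MvPolynomial.eval x p
    have hq : ContDiff ℝ ∞ q := contDiff_eval p
    -- For polynomials the identity follows from the moment formula just proved and the
    -- representation `hs` of `L_{∂s}`.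
    have hpoly : (-1) ^ n * ((∫ y in unitCube n, μ₁.real (Set.Iic y) * mixedDeriv q y) -
        ∫ y in unitCube n, μ₂.real (Set.Iic y) * mixedDeriv q y) =
        (∫ x, q x ∂μ₁) - ∫ x, q x ∂μ₂ := by
      rw [← hsplit (continuous_mixedDeriv hq), ← hs p, rieszFunctional_mixedDerivSeq,
        rieszFunctional_eq_integral hint hmom, mixedDeriv_eval]
      simp only [mul_comm]
    have hdiff : ∀ x ∈ unitCube n, |(q - ⇑φ) x| ≤ δ := hp
    have hb : ∀ (μ : Measure (Fin n → ℝ)) [IsFiniteMeasure μ], μ (unitCube n)ᶜ = 0 →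
        |(∫ y in unitCube n, μ.real (Set.Iic y) * mixedDeriv q y) -
          ∫ y in unitCube n, μ.real (Set.Iic y) * mixedDeriv φ y| ≤ 2 ^ n * δ * μ.real Set.univ ∧
        |(∫ x, q x ∂μ) - ∫ x, φ x ∂μ| ≤ δ * μ.real Set.univ := by
      intro μ _ hμ
      constructor
      · have h3 := abs_setIntegral_measureReal_Iic_mul_mixedDeriv_le μ hμ (g := q - ⇑φ) (hq.sub hφ) hdiff
        have h4 : mixedDeriv (q - ⇑φ) = mixedDeriv q - mixedDeriv φ := dirDeriv_sub hq hφ _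
        rw [h4] at h3
        simp only [Pi.sub_apply, mul_sub] at h3
        rwa [integral_sub (integrableOn_measureReal_Iic_mul μ (continuous_mixedDeriv hq))
          (integrableOn_measureReal_Iic_mul μ (continuous_mixedDeriv hφ))] at h3
      · rw [← integral_sub (integrable_of_continuous hμ hq.continuous)
          (integrable_of_continuous hμ hφ.continuous)]
        rw [← Real.norm_eq_abs]
        exact norm_integral_le_of_norm_le_const
          ((ae_mem_unitCube hμ).mono fun x hx => hdiff x hx)
    obtain ⟨hb1, hb1'⟩ := hb μ₁ h1
    obtain ⟨hb2, hb2'⟩ := hb μ₂ h2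
    have hKδ : K * δ ≤ ε := by
      rw [hδ_def, mul_div_assoc', div_le_iff₀ (by positivity)]
      nlinarith
    rw [zero_add]
    refine le_trans ?_ hKδ
    have hsign : ∀ t : ℝ, |(-1) ^ n * t| = |t| := fun t => by simp [abs_mul]
    generalize (∫ y in unitCube n, μ₁.real (Set.Iic y) * mixedDeriv q y) = q1 at *
    generalize (∫ y in unitCube n, μ₂.real (Set.Iic y) * mixedDeriv q y) = q2 at *
    generalize (∫ y in unitCube n, μ₁.real (Set.Iic y) * mixedDeriv φ y) = f1 at *
    generalize (∫ y in unitCube n, μ₂.real (Set.Iic y) * mixedDeriv φ y) = f2 at *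
    generalize (∫ x, q x ∂μ₁) = q1' at *
    generalize (∫ x, q x ∂μ₂) = q2' at *
    generalize (∫ x, φ x ∂μ₁) = f1' at *
    generalize (∫ x, φ x ∂μ₂) = f2' at *
    have hre : (-1) ^ n * (f1 - f2) - (f1' - f2') =
        (-1) ^ n * ((q2 - f2) - (q1 - f1)) + ((q1' - f1') - (q2' - f2')) := by
      linear_combination hpoly
    rw [hre]
    calc _ ≤ |(q2 - f2) - (q1 - f1)| + |(q1' - f1') - (q2' - f2')| := by
          rw [← hsign ((q2 - f2) - (q1 - f1))]; exact abs_add_le _ _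
      _ ≤ (|q2 - f2| + |q1 - f1|) + (|q1' - f1'| + |q2' - f2'|) :=
          add_le_add (abs_sub _ _) (abs_sub _ _)
      _ ≤ (2 ^ n * δ * m₂ + 2 ^ n * δ * m₁) + (δ * m₁ + δ * m₂) := by gcongr
      _ = K * δ := by rw [hK]; ring

end DistributionFunction

/-! ### Assembling the equivalence and the nonnegative version. -/

theorem exists_isRegularDensity_of_bernsteinSum_lt {n : ℕ} {s : (Fin n →₀ ℕ) → ℝ} {C : ℝ}
    (hC : ∀ d : Fin n → ℕ, bernsteinSum (mixedDerivSeq s) d < C) :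
    ∃ f : (Fin n → ℝ) → ℝ, IsRegularDensity s f := by
  obtain ⟨μ₁, μ₂, _, _, h1, h2, h⟩ := exists_measures_of_sum_abs_bernsteinBasis_le
    (rieszFunctional (mixedDerivSeq s)) (C := C) fun N => by
      rw [sum_abs_bernsteinBasis_eq_bernsteinSum]
      exact (hC _).le
  exact ⟨_, isRegularDensity_measureReal_Iic h1 h2 h⟩

theorem IsRegularDensity.ae_nonneg {n : ℕ} {s : (Fin n →₀ ℕ) → ℝ} {f : (Fin n → ℝ) → ℝ}
    (hf : IsRegularDensity s f)
    (hs : ∀ k l : Fin n → ℕ, 0 ≤ rieszFunctional s (bernsteinProd k l)) :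
    ∀ᵐ x ∂(volume.restrict (unitCube n)), 0 ≤ f x :=
  ae_nonneg_of_polynomial hf.integrableOn fun p hp => by
    rw [← rieszFunctional_eq_integral hf.integrableOn hf.moments]
    exact nonneg_of_bernsteinProd_nonneg _ hs hp

/-- Truncation alters `f` only on a null subset of the cube, so all integrals persist, and `max`
with 0 preserves points of continuity. -/
theorem IsRegularDensity.max_zero {n : ℕ} {s : (Fin n →₀ ℕ) → ℝ} {f : (Fin n → ℝ) → ℝ}
    (hf : IsRegularDensity s f) (h : ∀ᵐ x ∂(volume.restrict (unitCube n)), 0 ≤ f x) :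
    IsRegularDensity s fun x => max (f x) 0 := by
  have hae : f =ᵐ[volume.restrict (unitCube n)] fun x => max (f x) 0 :=
    h.mono fun x hx => (max_eq_left hx).symm
  refine ⟨hf.ae_continuous.mono fun x hx => hx.max continuousWithinAt_const,
    Integrable.congr hf.integrableOn hae, fun α => ?_, ?_⟩
  · rw [hf.moments α]
    exact integral_congr_ae (hae.mono fun x hx => by simp only [← hx])
  · obtain ⟨μ₁, μ₂, h1, h2, h3, h4, h5, h6, h7⟩ := hf.mixedDeriv
    refine ⟨μ₁, μ₂, h1, h2, h3, h4, h5, h6, fun φ => ?_⟩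
    rw [← h7 φ]
    congr 1
    exact integral_congr_ae (hae.mono fun x hx => by simp only [← hx])

end CubeMoment

theorem corollary3p4 (n : ℕ) (hn : 1 ≤ n) (s : (Fin n →₀ ℕ) → ℝ) :
    ((∃ f : (Fin n → ℝ) → ℝ, CubeMoment.IsRegularDensity s f) ↔
      ∃ C : ℝ, 0 < C ∧ ∀ d : Fin n → ℕ,
        CubeMoment.bernsteinSum s d < C ∧
        CubeMoment.bernsteinSum (CubeMoment.mixedDerivSeq s) d < C) ∧
    ((∀ k l : Fin n → ℕ, 0 ≤ CubeMoment.rieszFunctional s (CubeMoment.bernsteinProd k l)) →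
      (∀ f : (Fin n → ℝ) → ℝ, CubeMoment.IsRegularDensity s f →
        (∀ᵐ x ∂(volume.restrict (CubeMoment.unitCube n)), 0 ≤ f x) ∧
        (∀ x ∈ CubeMoment.unitCube n,
          ContinuousWithinAt f (CubeMoment.unitCube n) x → 0 ≤ f x)) ∧
      ((∃ f : (Fin n → ℝ) → ℝ, CubeMoment.IsRegularDensity s f) →
        ∃ f : (Fin n → ℝ) → ℝ, CubeMoment.IsRegularDensity s f ∧
          ∀ x ∈ CubeMoment.unitCube n, 0 ≤ f x)) := by
  refine ⟨⟨fun ⟨f, hf⟩ => hf.exists_bernsteinSum_lt, fun ⟨C, _, hC⟩ =>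
    CubeMoment.exists_isRegularDensity_of_bernsteinSum_lt fun d => (hC d).2⟩, fun hs => ⟨?_, ?_⟩⟩
  · intro f hf
    exact ⟨hf.ae_nonneg hs, fun x hx hc =>
      CubeMoment.nonneg_of_continuousWithinAt (hf.ae_nonneg hs) hx hc⟩
  · rintro ⟨f, hf⟩
    exact ⟨_, hf.max_zero (hf.ae_nonneg hs), fun x _ => le_max_right _ _⟩
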